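/- Let $\alpha>0$. Let $\mathcal F=\bigoplus_{n\ge 0}L^2_{\rm sym}((\mathbb R^3)^n)$ be the bosonic Fock space over $L^2(\mathbb R^3)$ in the momentum representation, let $N$ be the number operator and $P_f$ the phonon momentum, so that on $n$-phonon functions $N$ acts as multiplication by $n$ and $P_f$ as multiplication by $k_1+\dots+k_n$, and let $a(f),a^*(f)$ be the usual annihilation and creation operators with form factor $f$, $(a(f)\Psi)^{(n)}(k_1,\dots,k_n)=\sqrt{n+1}\int_{\mathbb R^3}\overline{f(k)}\,\Psi^{(n+1)}(k,k_1,\dots,k_n)\,dk$. Put $\hat v(k)=(4\pi|k|)^{-1}$ and $\hat v_\Lambda(k)=\hat v(k)\,\chi_{[0,\Lambda)}(|k|)$ for $k\in\mathbb R^3$. For $P\in\mathbb R^3$ let $H_0=(P-P_f)^2+N+1$, with its natural (maximal) domain $D(H_0)$ as a multiplication operator, and let $H(P)$, formally $(P-P_f)^2+N+\sqrt\alpha\,(a(\hat v)+a^*(\hat v))$, be defined as the operator such that $H(P)+1$ is associated with the quadratic form $$Q_P(\Psi)=\big\langle\Psi,\big((P-P_f)^2+N+1\big)\Psi\big\rangle+2\sqrt\alpha\,\operatorname{Re}\langle\Psi,a(\hat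 v)\Psi\rangle,\qquad \Psi\in D(H_0^{1/2}),$$ where $\langle\Phi,a(\hat v)\Psi\rangle=\sum_{n}\sqrt{n+1}\int\overline{\Phi^{(n)}(k_1,\dots,k_n)}\,\overline{\hat v(k)}\,\Psi^{(n+1)}(k,k_1,\dots,k_n)\,dk\,dk_1\cdots dk_n$. That is, with $Q_P(\Phi,\Psi)$ the corresponding sesquilinear form (linear in $\Psi$), $\Psi\in D(H(P))$ and $H(P)\Psi=\eta\in\mathcal F$ if and only if $\Psi\in D(H_0^{1/2})$ and $Q_P(\Phi,\Psi)=\langle\Phi,\eta+\Psi\rangle$ for all $\Phi\in D(H_0^{1/2})$. Then for every $\Lambda>0$ and $P\in\mathbb R^3$ the operator $$H_\Lambda(P)=(P-P_f)^2+N+\sqrt\alpha\,\big(a(\hat v_\Lambda)+a^*(\hat v_\Lambda)\big)$$ is well defined and self-adjoint with domain $D(H_\Lambda(P))=D(H_0)$, the operator $H(P)$ is self-adjoint for every $P\in\mathbb R^3$, and $H_\Lambda(P)$ converges to $H(P)$ in norm-resolvent sense as $\Lambda\to\infty$, uniformly in $P\in\mathbb R^3$: for every $z\in\mathbb C\setminus\mathbb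 R$, $$\lim_{\Lambda\to\infty}\ \sup_{P\in\mathbb R^3}\big\|(H_\Lambda(P)-z)^{-1}-(H(P)-z)^{-1}\big\|=0 .$$ -/

import Mathlib

open MeasureTheory Filter Topology ComplexConjugate

noncomputable section

namespace Polaron

/-! ### The bosonic Fock space over `L²(ℝ³)`, in the momentum representation -/

/-- Momentum space `ℝ³`, with the Euclidean norm and Lebesgue measure. -/
abbrev R3 : Type := EuclideanSpace ℝ (Fin 3)

/-- `L²((ℝ³)ⁿ)`: wave functions of `n` distinguishable phonons. -/
abbrev L2n (n : ℕ) : Type := Lp ℂ 2 (volume : Measure (Fin n → R3))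

theorem measurePreserving_perm (n : ℕ) (σ : Equiv.Perm (Fin n)) :
    MeasurePreserving (fun K : Fin n → R3 => K ∘ σ) volume volume := by
  have h := volume_measurePreserving_piCongrLeft (fun _ : Fin n => R3) σ.symm
  have e : (MeasurableEquiv.piCongrLeft (fun _ : Fin n => R3) σ.symm : (Fin n → R3) → Fin n → R3)
      = fun K => K ∘ σ := by
    funext K i
    simpa using MeasurableEquiv.piCongrLeft_apply_apply (β := fun _ : Fin n => R3) σ.symm K (σ i)
  rwa [e] at h

/-- The `n`-phonon space: the elements of `L²((ℝ³)ⁿ)` that are invariant under all permutations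
of the `n` momenta. -/
def symL2 (n : ℕ) : Submodule ℂ (L2n n) where
  carrier := {f | ∀ σ : Equiv.Perm (Fin n), (fun K => f (K ∘ σ)) =ᵐ[volume] f}
  zero_mem' := fun σ => by
    have h := Lp.coeFn_zero ℂ 2 (volume : Measure (Fin n → R3))
    have h' := (measurePreserving_perm n σ).quasiMeasurePreserving.ae_eq_comp h
    filter_upwards [h, h'] with K h1 h2
    simp only [Function.comp_apply] at h2
    rw [h1, h2]
    rfl
  add_mem' := fun {f g} hf hg σ => by
    have h := Lp.coeFn_add f g
    have h' := (measurePreserving_perm n σ).quasiMeasurePreserving.ae_eq_comp h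
    filter_upwards [h, h', hf σ, hg σ] with K h1 h2 h3 h4
    simp only [Function.comp_apply, Pi.add_apply] at h1 h2 h3 h4 ⊢
    rw [h1, h2, h3, h4]
  smul_mem' := fun c f hf σ => by
    have h := Lp.coeFn_smul c f
    have h' := (measurePreserving_perm n σ).quasiMeasurePreserving.ae_eq_comp h
    filter_upwards [h, h', hf σ] with K h1 h2 h3
    simp only [Function.comp_apply, Pi.smul_apply] at h1 h2 h3 ⊢
    rw [h1, h2, h3]

theorem isClosed_symL2 (n : ℕ) : IsClosed (symL2 n : Set (L2n n)) := by
  have h : (symL2 n : Set (L2n n)) = ⋂ σ : Equiv.Perm (Fin n),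
      {f | Lp.compMeasurePreserving _ (measurePreserving_perm n σ) f = f} := by
    ext f
    simp only [Set.mem_iInter]
    refine forall_congr' fun σ => ?_
    have h1 := Lp.coeFn_compMeasurePreserving f (measurePreserving_perm n σ)
    constructor
    · intro h
      exact Lp.ext (h1.trans h)
    · intro h
      have h2 : Lp.compMeasurePreserving _ (measurePreserving_perm n σ) f = f := h
      rw [h2] at h1
      exact h1.symm
  rw [h]
  exact isClosed_iInter fun σ => isClosed_eq
    (Lp.isometry_compMeasurePreserving (measurePreserving_perm n σ)).continuous continuous_id

instance completeSpace_symL2 (n : ℕ) : CompleteSpace (symL2 n) :=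
  (isClosed_symL2 n).completeSpace_coe

/-- The bosonic Fock space `⨁ₙ L²_sym((ℝ³)ⁿ)` (Hilbert space direct sum). -/
abbrev Fock : Type := lp (fun n : ℕ => symL2 n) 2

/-- The `n`-phonon wave function of `Ψ` (a function defined up to null sets). -/
def sector (Ψ : Fock) (n : ℕ) : (Fin n → R3) → ℂ := ((Ψ n : symL2 n) : L2n n)

theorem sector_zero (n : ℕ) : sector 0 n =ᵐ[volume] 0 := Lp.coeFn_zero _ _ _

theorem sector_add (Ψ Φ : Fock) (n : ℕ) :
    sector (Ψ + Φ) n =ᵐ[volume] sector Ψ n + sector Φ n := Lp.coeFn_add _ _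

theorem sector_smul (c : ℂ) (Ψ : Fock) (n : ℕ) :
    sector (c • Ψ) n =ᵐ[volume] c • sector Ψ n := Lp.coeFn_smul _ _

theorem Fock.ext_sector {Ψ Φ : Fock} (h : ∀ n, sector Ψ n =ᵐ[volume] sector Φ n) : Ψ = Φ :=
  lp.ext (funext fun n => Subtype.ext (Lp.ext (h n)))

/-! ### Annihilation and creation operators, sector by sector -/

/-- The integral defining `a(f)ψ` converges for almost every value of the remaining momenta. -/
def AnnihConverges (f : R3 → ℂ) (n : ℕ) (ψ : (Fin (n + 1) → R3) → ℂ) : Prop :=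
  ∀ᵐ K : Fin n → R3, Integrable fun k : R3 => conj (f k) * ψ (Fin.cons k K)

/-- `(a(f)ψ)(k₁,…,kₙ) = √(n+1) ∫ conj f(k) ψ(k,k₁,…,kₙ) dk`, from `n+1` phonons to `n`. -/
def annih (f : R3 → ℂ) (n : ℕ) (ψ : (Fin (n + 1) → R3) → ℂ) : (Fin n → R3) → ℂ :=
  fun K => (Real.sqrt (n + 1) : ℂ) * ∫ k : R3, conj (f k) * ψ (Fin.cons k K)

/-- `(a*(f)ψ)(k₁,…,kₙ₊₁) = (n+1)^{-1/2} ∑ⱼ f(kⱼ) ψ(k₁,…,kⱼ₋₁,kⱼ₊₁,…,kₙ₊₁)`, from `n` phonons to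
`n+1`. -/
def creat (f : R3 → ℂ) (n : ℕ) (ψ : (Fin n → R3) → ℂ) : (Fin (n + 1) → R3) → ℂ :=
  fun K => ((Real.sqrt (n + 1) : ℂ))⁻¹ * ∑ j : Fin (n + 1), f (K j) * ψ (j.removeNth K)

/-- The `n`-phonon component of `a*(f)Ψ`; it vanishes for `n = 0`. -/
def creatSector (f : R3 → ℂ) (Ψ : Fock) : (n : ℕ) → (Fin n → R3) → ℂ
  | 0 => 0
  | n + 1 => creat f n (sector Ψ n)

/-! ### The model -/

/-- The symbol of `H₀ = (P - P_f)² + N + 1` on the `n`-phonon sector: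
`(P - (k₁ + ⋯ + kₙ))² + n + 1`. -/
def freeSymbol (P : R3) (n : ℕ) (K : Fin n → R3) : ℝ := ‖P - ∑ j, K j‖ ^ 2 + n + 1

/-- The maximal domain of the operator acting on each sector as multiplication by `w n`. -/
def mulDomain (w : (n : ℕ) → (Fin n → R3) → ℝ) : Submodule ℂ Fock where
  carrier := {Ψ | ∃ η : Fock, ∀ n, sector η n =ᵐ[volume] fun K => (w n K : ℂ) * sector Ψ n K}
  zero_mem' := ⟨0, fun n => by
    filter_upwards [sector_zero n] with K h
    simp [h]⟩
  add_mem' := fun {Ψ Φ} ⟨η, hη⟩ ⟨θ, hθ⟩ => ⟨η + θ, fun n => by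
    filter_upwards [sector_add Ψ Φ n, sector_add η θ n, hη n, hθ n] with K h1 h2 h3 h4
    rw [h2, Pi.add_apply, h3, h4, h1, Pi.add_apply]
    ring⟩
  smul_mem' := fun c Ψ ⟨η, hη⟩ => ⟨c • η, fun n => by
    filter_upwards [sector_smul c Ψ n, sector_smul c η n, hη n] with K h1 h2 h3
    rw [h2, Pi.smul_apply, h3, h1, Pi.smul_apply, smul_eq_mul, smul_eq_mul]
    ring⟩

/-- The operator domain `D(H₀)`. -/
def freeDomain (P : R3) : Submodule ℂ Fock := mulDomain (freeSymbol P)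

/-- The form domain `D(H₀^{1/2})`. -/
def formDomain (P : R3) : Submodule ℂ Fock := mulDomain fun n K => Real.sqrt (freeSymbol P n K)

/-- The form factor `v̂(k) = 1 / (4π|k|)` of the Fröhlich polaron. -/
def vHat (k : R3) : ℂ := ((1 / (4 * Real.pi * ‖k‖) : ℝ) : ℂ)

/-- The form factor with ultraviolet cutoff, `v̂_Λ(k) = v̂(k) χ_{[0,Λ)}(|k|)`. -/
def vHatCut (Λ : ℝ) (k : R3) : ℂ := {k : R3 | ‖k‖ < Λ}.indicator vHat k

/-! ### Respecting null sets -/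

theorem ae_cons {n : ℕ} {p : (Fin (n + 1) → R3) → Prop} (h : ∀ᵐ x, p x) :
    ∀ᵐ K : Fin n → R3, ∀ᵐ k : R3, p (Fin.cons k K) := by
  have h1 := (volume_preserving_piFinSuccAbove (fun _ : Fin (n + 1) => R3) 0).symm
  have h2 : ∀ᵐ y : R3 × (Fin n → R3), p (Fin.cons y.1 y.2) := by
    have := h1.quasiMeasurePreserving.ae h
    simpa [MeasurableEquiv.piFinSuccAbove, Fin.insertNthEquiv, Fin.insertNth_zero'] using this
  have h3 := Measure.measurePreserving_swap (μ := (volume : Measure (Fin n → R3)))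
    (ν := (volume : Measure R3)) |>.quasiMeasurePreserving.ae h2
  exact Measure.ae_ae_of_ae_prod h3

theorem ae_removeNth {n : ℕ} {p : (Fin n → R3) → Prop} (h : ∀ᵐ K, p K) (j : Fin (n + 1)) :
    ∀ᵐ x : Fin (n + 1) → R3, p (j.removeNth x) := by
  have h1 := (volume_preserving_piFinSuccAbove (fun _ : Fin (n + 1) => R3) j)
  have h2 : ∀ᵐ y : R3 × (Fin n → R3), p y.2 := Measure.quasiMeasurePreserving_snd.ae h
  exact h1.quasiMeasurePreserving.ae h2

section

variable {f : R3 → ℂ} {n : ℕ}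

theorem annihConverges_congr {φ ψ : (Fin (n + 1) → R3) → ℂ} (h : φ =ᵐ[volume] ψ)
    (hφ : AnnihConverges f n φ) : AnnihConverges f n ψ := by
  filter_upwards [ae_cons h, hφ] with K h1 h2
  refine h2.congr ?_
  filter_upwards [h1] with k hk
  rw [hk]

theorem annih_congr {φ ψ : (Fin (n + 1) → R3) → ℂ} (h : φ =ᵐ[volume] ψ) :
    annih f n φ =ᵐ[volume] annih f n ψ := by
  filter_upwards [ae_cons h] with K h1
  unfold annih
  congr 1
  refine integral_congr_ae ?_
  filter_upwards [h1] with k hk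
  rw [hk]

theorem annihConverges_zero : AnnihConverges f n 0 := by
  refine Eventually.of_forall fun K => ?_
  simp

theorem annih_zero : annih f n 0 = 0 := by
  funext K
  simp [annih]

theorem AnnihConverges.add {φ ψ : (Fin (n + 1) → R3) → ℂ} (hφ : AnnihConverges f n φ)
    (hψ : AnnihConverges f n ψ) : AnnihConverges f n (φ + ψ) := by
  filter_upwards [hφ, hψ] with K h1 h2
  refine (h1.add h2).congr (Eventually.of_forall fun k => ?_)
  simp only [Pi.add_apply, mul_add]

theorem AnnihConverges.annih_add {φ ψ : (Fin (n + 1) → R3) → ℂ} (hφ : AnnihConverges f n φ)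
    (hψ : AnnihConverges f n ψ) :
    annih f n (φ + ψ) =ᵐ[volume] annih f n φ + annih f n ψ := by
  filter_upwards [hφ, hψ] with K h1 h2
  simp only [annih, Pi.add_apply, mul_add]
  rw [integral_add h1 h2, mul_add]

theorem AnnihConverges.smul {φ : (Fin (n + 1) → R3) → ℂ} (c : ℂ) (hφ : AnnihConverges f n φ) :
    AnnihConverges f n (c • φ) := by
  filter_upwards [hφ] with K h1
  refine (h1.const_mul c).congr (Eventually.of_forall fun k => ?_)
  simp only [Pi.smul_apply, smul_eq_mul]
  ring

theorem annih_smul (c : ℂ) (φ : (Fin (n + 1) → R3) → ℂ) :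
    annih f n (c • φ) = c • annih f n φ := by
  funext K
  simp only [annih, Pi.smul_apply, smul_eq_mul]
  rw [mul_left_comm, ← integral_const_mul (r := c)]
  congr 2
  funext k
  ring

theorem creat_congr {φ ψ : (Fin n → R3) → ℂ} (h : φ =ᵐ[volume] ψ) :
    creat f n φ =ᵐ[volume] creat f n ψ := by
  have h1 : ∀ᵐ x : Fin (n + 1) → R3, ∀ j : Fin (n + 1),
      φ (j.removeNth x) = ψ (j.removeNth x) := ae_all_iff.2 fun j => ae_removeNth h j
  filter_upwards [h1] with x hx
  simp only [creat, hx]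

theorem creatSector_zero (f : R3 → ℂ) (n : ℕ) : creatSector f 0 n =ᵐ[volume] 0 := by
  cases n with
  | zero => exact EventuallyEq.rfl
  | succ n =>
    refine (creat_congr (sector_zero n)).trans (Eventually.of_forall fun K => ?_)
    simp [creat]

theorem creatSector_add (f : R3 → ℂ) (Ψ Φ : Fock) (n : ℕ) :
    creatSector f (Ψ + Φ) n =ᵐ[volume] creatSector f Ψ n + creatSector f Φ n := by
  cases n with
  | zero => simp [creatSector]
  | succ n =>
    refine (creat_congr (sector_add Ψ Φ n)).trans (Eventually.of_forall fun K => ?_)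
    simp [creatSector, creat, mul_add, Finset.sum_add_distrib]

theorem creatSector_smul (f : R3 → ℂ) (c : ℂ) (Ψ : Fock) (n : ℕ) :
    creatSector f (c • Ψ) n =ᵐ[volume] c • creatSector f Ψ n := by
  cases n with
  | zero => simp [creatSector]
  | succ n =>
    refine (creat_congr (sector_smul c Ψ n)).trans (Eventually.of_forall fun K => ?_)
    simp only [creatSector, creat, Pi.smul_apply, smul_eq_mul, mul_left_comm _ c,
      ← Finset.mul_sum]

end

/-! ### The Hamiltonian with cutoff, as an operator on `D(H₀)` -/

/-- `(Ψ, η)` belongs to the graph of `(P - P_f)² + N + √α (a(f) + a*(f))`: `Ψ ∈ D(H₀)`, and `η` is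
the Fock space vector obtained by applying this expression to `Ψ` sector by sector. -/
def cutoffGraph (α : ℝ) (f : R3 → ℂ) (P : R3) : Submodule ℂ (Fock × Fock) where
  carrier := {x | x.1 ∈ freeDomain P ∧
    (∀ n, AnnihConverges f n (sector x.1 (n + 1))) ∧
    ∀ n, sector x.2 n =ᵐ[volume] fun K =>
      ((freeSymbol P n K - 1 : ℝ) : ℂ) * sector x.1 n K +
        (Real.sqrt α : ℂ) * (annih f n (sector x.1 (n + 1)) K + creatSector f x.1 n K)}
  zero_mem' := by
    refine ⟨Submodule.zero_mem _, fun n => annihConverges_congr (sector_zero _).symm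
      annihConverges_zero, fun n => ?_⟩
    filter_upwards [sector_zero n, creatSector_zero f n,
      annih_congr (f := f) (sector_zero (n + 1))] with K h1 h2 h3
    simp only [Prod.fst_zero, Prod.snd_zero]
    rw [h1, h2, h3, annih_zero]
    simp
  add_mem' := by
    rintro ⟨Ψ, η⟩ ⟨Φ, θ⟩ ⟨hΨ, cΨ, eΨ⟩ ⟨hΦ, cΦ, eΦ⟩
    refine ⟨Submodule.add_mem _ hΨ hΦ, fun n => annihConverges_congr (sector_add _ _ _).symm
      ((cΨ n).add (cΦ n)), fun n => ?_⟩
    filter_upwards [sector_add Ψ Φ n, sector_add η θ n, creatSector_add f Ψ Φ n,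
      annih_congr (f := f) (sector_add Ψ Φ (n + 1)), (cΨ n).annih_add (cΦ n), eΨ n, eΦ n]
      with K h1 h2 h3 h4 h5 h6 h7
    simp only [Prod.mk_add_mk, Pi.add_apply] at h1 h2 h3 h4 h5 h6 h7 ⊢
    rw [h1, h2, h3, h4, h5, h6, h7]
    ring
  smul_mem' := by
    rintro c ⟨Ψ, η⟩ ⟨hΨ, cΨ, eΨ⟩
    refine ⟨Submodule.smul_mem _ c hΨ, fun n => annihConverges_congr (sector_smul _ _ _).symm
      ((cΨ n).smul c), fun n => ?_⟩
    filter_upwards [sector_smul c Ψ n, sector_smul c η n, creatSector_smul f c Ψ n,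
      annih_congr (f := f) (sector_smul c Ψ (n + 1)), eΨ n] with K h1 h2 h3 h4 h5
    rw [annih_smul] at h4
    simp only [Prod.smul_mk, Pi.smul_apply, smul_eq_mul] at h1 h2 h3 h4 h5 ⊢
    rw [h1, h2, h3, h4, h5]
    ring

/-- The graph is single-valued. -/
theorem cutoffGraph_functional (α : ℝ) (f : R3 → ℂ) (P : R3) (x : Fock × Fock)
    (hx : x ∈ cutoffGraph α f P) (h0 : x.1 = 0) : x.2 = 0 := by
  obtain ⟨Ψ, η⟩ := x
  obtain rfl : Ψ = 0 := h0
  refine Fock.ext_sector fun n => ?_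
  filter_upwards [hx.2.2 n, sector_zero n, creatSector_zero f n,
    annih_congr (f := f) (sector_zero (n + 1))] with K h h1 h2 h3
  rw [h, h1, h2, h3, annih_zero]
  simp

/-- The fiber Hamiltonian with cutoff, `H_Λ(P) = (P - P_f)² + N + √α φ(v_Λ)`, acting on those
`Ψ ∈ D(H₀)` for which the expression defines a vector of Fock space. -/
def cutoffHamiltonian (α Λ : ℝ) (P : R3) : Fock →ₗ.[ℂ] Fock :=
  (cutoffGraph α (vHatCut Λ) P).toLinearPMap

theorem cutoffHamiltonian_graph (α Λ : ℝ) (P : R3) :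
    (cutoffHamiltonian α Λ P).graph = cutoffGraph α (vHatCut Λ) P :=
  Submodule.toLinearPMap_graph_eq _ (cutoffGraph_functional α _ P)

/-! ### The Hamiltonian without cutoff, through its quadratic form -/

/-- The integrand of `⟨φ, a(f)ψ⟩` for `φ` with `n` and `ψ` with `n + 1` phonons, as a function of the
`n + 1` momenta (up to the factor `√(n+1)`). -/
def annihKernel (f : R3 → ℂ) {n : ℕ} (φ : (Fin n → R3) → ℂ) (ψ : (Fin (n + 1) → R3) → ℂ) :
    (Fin (n + 1) → R3) → ℂ :=
  fun K => conj (φ (Fin.tail K)) * (conj (f (K 0)) * ψ K)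

/-- `⟨φ, a(f)ψ⟩ = √(n+1) ∫ conj φ(k₁,…,kₙ) conj f(k) ψ(k,k₁,…,kₙ) dk dk₁ ⋯ dkₙ`. -/
def annihForm (f : R3 → ℂ) {n : ℕ} (φ : (Fin n → R3) → ℂ) (ψ : (Fin (n + 1) → R3) → ℂ) : ℂ :=
  (Real.sqrt (n + 1) : ℂ) * ∫ K, annihKernel f φ ψ K

/-- The integrand of `⟨φ, H₀ψ⟩` on the `n`-phonon sector. -/
def freeKernel (P : R3) {n : ℕ} (φ ψ : (Fin n → R3) → ℂ) : (Fin n → R3) → ℂ :=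
  fun K => conj (φ K) * ((freeSymbol P n K : ℂ) * ψ K)

/-- The `n`-th term of the sesquilinear form
`⟨Φ, ((P - P_f)² + N + 1)Ψ⟩ + √α (⟨Φ, a(v)Ψ⟩ + conj ⟨Ψ, a(v)Φ⟩)`. -/
def formTerm (α : ℝ) (P : R3) (Φ Ψ : Fock) (n : ℕ) : ℂ :=
  (∫ K, freeKernel P (sector Φ n) (sector Ψ n) K) +
    (Real.sqrt α : ℂ) * (annihForm vHat (sector Φ n) (sector Ψ (n + 1)) +
      conj (annihForm vHat (sector Ψ n) (sector Φ (n + 1))))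

/-- All integrals in `formTerm α P Φ Ψ n` converge (as Lebesgue integrals). -/
def FormTermConverges (P : R3) (Φ Ψ : Fock) (n : ℕ) : Prop :=
  Integrable (freeKernel P (sector Φ n) (sector Ψ n)) ∧
    Integrable (annihKernel vHat (sector Φ n) (sector Ψ (n + 1))) ∧
    Integrable (annihKernel vHat (sector Ψ n) (sector Φ (n + 1)))

/-- The sesquilinear form `Q_P(Φ, Ψ)`, whose diagonal is
`Q_P(Ψ) = ⟨Ψ, ((P - P_f)² + N + 1)Ψ⟩ + 2√α Re ⟨Ψ, a(v)Ψ⟩`, converges and has the value `c`. -/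
def HasForm (α : ℝ) (P : R3) (Φ Ψ : Fock) (c : ℂ) : Prop :=
  (∀ n, FormTermConverges P Φ Ψ n) ∧ HasSum (formTerm α P Φ Ψ) c

section

variable {P : R3} {Φ : Fock} {n : ℕ}

theorem ae_tail {p : (Fin n → R3) → Prop} (h : ∀ᵐ K, p K) :
    ∀ᵐ x : Fin (n + 1) → R3, p (Fin.tail x) := by
  have := ae_removeNth h 0
  simpa only [Fin.removeNth_zero] using this

theorem freeKernel_zero_ae : freeKernel P (sector Φ n) (sector 0 n) =ᵐ[volume] 0 := by
  filter_upwards [sector_zero n] with K h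
  simp [freeKernel, h]

theorem annihKernel_zero_ae (φ : (Fin n → R3) → ℂ) :
    annihKernel vHat φ (sector 0 (n + 1)) =ᵐ[volume] 0 := by
  filter_upwards [sector_zero (n + 1)] with K h
  simp [annihKernel, h]

theorem annihKernel_zero_ae' (ψ : (Fin (n + 1) → R3) → ℂ) :
    annihKernel vHat (sector 0 n) ψ =ᵐ[volume] 0 := by
  filter_upwards [ae_tail (sector_zero n)] with K h
  simp [annihKernel, h]

theorem freeKernel_add_ae (Ψ Θ : Fock) : freeKernel P (sector Φ n) (sector (Ψ + Θ) n) =ᵐ[volume]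
    freeKernel P (sector Φ n) (sector Ψ n) + freeKernel P (sector Φ n) (sector Θ n) := by
  filter_upwards [sector_add Ψ Θ n] with K h
  simp only [freeKernel, h, Pi.add_apply]
  ring

theorem annihKernel_add_ae (φ : (Fin n → R3) → ℂ) (Ψ Θ : Fock) :
    annihKernel vHat φ (sector (Ψ + Θ) (n + 1)) =ᵐ[volume]
      annihKernel vHat φ (sector Ψ (n + 1)) + annihKernel vHat φ (sector Θ (n + 1)) := by
  filter_upwards [sector_add Ψ Θ (n + 1)] with K h
  simp only [annihKernel, h, Pi.add_apply]
  ring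

theorem annihKernel_add_ae' (Ψ Θ : Fock) (ψ : (Fin (n + 1) → R3) → ℂ) :
    annihKernel vHat (sector (Ψ + Θ) n) ψ =ᵐ[volume]
      annihKernel vHat (sector Ψ n) ψ + annihKernel vHat (sector Θ n) ψ := by
  filter_upwards [ae_tail (sector_add Ψ Θ n)] with K h
  simp only [annihKernel, h, Pi.add_apply, map_add]
  ring

theorem freeKernel_smul_ae (c : ℂ) (Ψ : Fock) :
    freeKernel P (sector Φ n) (sector (c • Ψ) n) =ᵐ[volume]
      c • freeKernel P (sector Φ n) (sector Ψ n) := by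
  filter_upwards [sector_smul c Ψ n] with K h
  simp only [freeKernel, h, Pi.smul_apply, smul_eq_mul]
  ring

theorem annihKernel_smul_ae (φ : (Fin n → R3) → ℂ) (c : ℂ) (Ψ : Fock) :
    annihKernel vHat φ (sector (c • Ψ) (n + 1)) =ᵐ[volume]
      c • annihKernel vHat φ (sector Ψ (n + 1)) := by
  filter_upwards [sector_smul c Ψ (n + 1)] with K h
  simp only [annihKernel, h, Pi.smul_apply, smul_eq_mul]
  ring

theorem annihKernel_smul_ae' (c : ℂ) (Ψ : Fock) (ψ : (Fin (n + 1) → R3) → ℂ) :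
    annihKernel vHat (sector (c • Ψ) n) ψ =ᵐ[volume]
      conj c • annihKernel vHat (sector Ψ n) ψ := by
  filter_upwards [ae_tail (sector_smul c Ψ n)] with K h
  simp only [annihKernel, h, Pi.smul_apply, smul_eq_mul, map_mul]
  ring

theorem formTerm_zero (α : ℝ) : formTerm α P Φ 0 n = 0 := by
  simp only [formTerm, annihForm, integral_congr_ae freeKernel_zero_ae,
    integral_congr_ae (annihKernel_zero_ae _), integral_congr_ae (annihKernel_zero_ae' _)]
  simp

theorem HasForm.zero_right (α : ℝ) (P : R3) (Φ : Fock) : HasForm α P Φ 0 0 := by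
  refine ⟨fun n => ⟨(integrable_zero _ _ _).congr freeKernel_zero_ae.symm,
    (integrable_zero _ _ _).congr (annihKernel_zero_ae _).symm,
    (integrable_zero _ _ _).congr (annihKernel_zero_ae' _).symm⟩, ?_⟩
  have : formTerm α P Φ 0 = fun _ => 0 := funext fun n => formTerm_zero α
  rw [this]
  exact hasSum_zero

theorem HasForm.add_right {α : ℝ} {Ψ Θ : Fock} {c d : ℂ} (h : HasForm α P Φ Ψ c)
    (h' : HasForm α P Φ Θ d) : HasForm α P Φ (Ψ + Θ) (c + d) := by
  refine ⟨fun n => ?_, ?_⟩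
  · obtain ⟨h1, h2, h3⟩ := h.1 n
    obtain ⟨k1, k2, k3⟩ := h'.1 n
    exact ⟨(h1.add k1).congr (freeKernel_add_ae _ _).symm,
      (h2.add k2).congr (annihKernel_add_ae _ _ _).symm,
      (h3.add k3).congr (annihKernel_add_ae' _ _ _).symm⟩
  · have e : formTerm α P Φ (Ψ + Θ) = fun n => formTerm α P Φ Ψ n + formTerm α P Φ Θ n := by
      funext n
      obtain ⟨h1, h2, h3⟩ := h.1 n
      obtain ⟨k1, k2, k3⟩ := h'.1 n
      simp only [formTerm, annihForm, integral_congr_ae (freeKernel_add_ae _ _),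
        integral_congr_ae (annihKernel_add_ae _ _ _),
        integral_congr_ae (annihKernel_add_ae' _ _ _)]
      rw [integral_add' h1 k1, integral_add' h2 k2, integral_add' h3 k3]
      simp only [map_mul, map_add]
      ring
    rw [e]
    exact h.2.add h'.2

theorem HasForm.smul_right {α : ℝ} {Ψ : Fock} {c : ℂ} (a : ℂ) (h : HasForm α P Φ Ψ c) :
    HasForm α P Φ (a • Ψ) (a * c) := by
  refine ⟨fun n => ?_, ?_⟩
  · obtain ⟨h1, h2, h3⟩ := h.1 n
    exact ⟨(h1.smul a).congr (freeKernel_smul_ae _ _).symm,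
      (h2.smul a).congr (annihKernel_smul_ae _ _ _).symm,
      (h3.smul (conj a)).congr (annihKernel_smul_ae' _ _ _).symm⟩
  · have e : formTerm α P Φ (a • Ψ) = fun n => a * formTerm α P Φ Ψ n := by
      funext n
      simp only [formTerm, annihForm, integral_congr_ae (freeKernel_smul_ae _ _),
        integral_congr_ae (annihKernel_smul_ae _ _ _),
        integral_congr_ae (annihKernel_smul_ae' _ _ _), Pi.smul_apply, smul_eq_mul,
        integral_const_mul, map_mul, Complex.conj_conj]
      ring
    rw [e]
    exact h.2.mul_left a

end

/-- `(Ψ, η)` belongs to the graph of the operator associated with the form: `Ψ ∈ D(H₀^{1/2})` and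
`Q_P(Φ, Ψ) = ⟨Φ, η + Ψ⟩` for all `Φ ∈ D(H₀^{1/2})`; the shift by `Ψ` appears because `Q_P` is the
form of `H(P) + 1`. -/
def fiberGraph (α : ℝ) (P : R3) : Submodule ℂ (Fock × Fock) where
  carrier := {x | x.1 ∈ formDomain P ∧
    ∀ Φ ∈ formDomain P, HasForm α P Φ x.1 (inner ℂ Φ (x.2 + x.1))}
  zero_mem' := by
    refine ⟨Submodule.zero_mem _, fun Φ _ => ?_⟩
    simpa using HasForm.zero_right α P Φ
  add_mem' := by
    rintro ⟨Ψ, η⟩ ⟨Θ, θ⟩ ⟨hΨ, eΨ⟩ ⟨hΘ, eΘ⟩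
    refine ⟨Submodule.add_mem _ hΨ hΘ, fun Φ hΦ => ?_⟩
    have h := (eΨ Φ hΦ).add_right (eΘ Φ hΦ)
    rw [← inner_add_right, add_add_add_comm] at h
    exact h
  smul_mem' := by
    rintro c ⟨Ψ, η⟩ ⟨hΨ, eΨ⟩
    refine ⟨Submodule.smul_mem _ c hΨ, fun Φ hΦ => ?_⟩
    have h := (eΨ Φ hΦ).smul_right c
    rw [← inner_smul_right, smul_add] at h
    exact h

theorem one_le_freeSymbol (P : R3) (n : ℕ) (K : Fin n → R3) : 1 ≤ freeSymbol P n K := by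
  unfold freeSymbol
  have : (0 : ℝ) ≤ n := n.cast_nonneg
  nlinarith [sq_nonneg ‖P - ∑ j, K j‖]

theorem continuous_freeSymbol (P : R3) (n : ℕ) : Continuous (freeSymbol P n) := by
  unfold freeSymbol
  fun_prop

theorem freeSymbol_perm (P : R3) (n : ℕ) (K : Fin n → R3) (σ : Equiv.Perm (Fin n)) :
    freeSymbol P n (K ∘ σ) = freeSymbol P n K := by
  unfold freeSymbol
  simp only [Function.comp_apply, Equiv.sum_comp σ K]

/-- The form domain is dense: only `0` is orthogonal to it. -/
theorem eq_zero_of_orthogonal_formDomain (P : R3) (η : Fock)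
    (h : ∀ Φ ∈ formDomain P, inner ℂ Φ η = 0) : η = 0 := by
  refine Fock.ext_sector fun n => ?_
  refine EventuallyEq.trans ?_ (sector_zero n).symm
  set w : (Fin n → R3) → ℝ := fun K => Real.sqrt (freeSymbol P n K) with hw
  have hw1 : ∀ K, 1 ≤ w K := fun K => Real.one_le_sqrt.2 (one_le_freeSymbol P n K)
  have hwc : Continuous w := (continuous_freeSymbol P n).sqrt
  have hη : MemLp (sector η n) 2 := Lp.memLp _
  have hm : MemLp (fun K => ((w K)⁻¹ : ℂ) * sector η n K) 2 := by
    refine hη.mono ?_ (Eventually.of_forall fun K => ?_)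
    · refine AEStronglyMeasurable.mul ?_ hη.1
      exact (Complex.measurable_ofReal.comp hwc.measurable).inv.aestronglyMeasurable
    · rw [norm_mul, norm_inv, Complex.norm_real, Real.norm_of_nonneg (by linarith [hw1 K])]
      exact mul_le_of_le_one_left (norm_nonneg _) (inv_le_one_of_one_le₀ (hw1 K))
  have hc := hm.coeFn_toLp
  have hs : hm.toLp ∈ symL2 n := fun σ => by
    have h2 := (measurePreserving_perm n σ).quasiMeasurePreserving.ae_eq_comp hc
    filter_upwards [hc, h2, (η n).2 σ] with K h3 h4 h5
    simp only [Function.comp_apply] at h4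
    rw [h4, h3]
    have h6 : sector η n (K ∘ σ) = sector η n K := h5
    rw [h6]
    simp only [hw, freeSymbol_perm]
  have hdom : (lp.single 2 n (⟨hm.toLp, hs⟩ : symL2 n) : Fock) ∈ formDomain P := by
    refine ⟨lp.single 2 n (η n), fun m => ?_⟩
    by_cases hmn : m = n
    · subst hmn
      have e : ∀ a : symL2 m, sector (lp.single 2 m a : Fock) m = (a : L2n m) := fun a => by
        simp only [sector, lp.coeFn_single, Pi.single_eq_same]
      rw [e, e]
      filter_upwards [hc] with K hK
      have h1 : (w K : ℂ) ≠ 0 := by exact_mod_cast (by linarith [hw1 K] : w K ≠ 0)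
      calc sector η m K = (w K : ℂ) * ((w K : ℂ)⁻¹ * sector η m K) := by
            rw [← mul_assoc, mul_inv_cancel₀ h1, one_mul]
        _ = _ := by rw [← hK]
    · have e : ∀ a : symL2 n, sector (lp.single 2 n a : Fock) m =ᵐ[volume] 0 := fun a => by
        simp only [sector, lp.coeFn_single, Pi.single_eq_of_ne hmn]
        exact Lp.coeFn_zero _ _ _
      filter_upwards [e (η n), e ⟨hm.toLp, hs⟩] with K h1 h2
      rw [h1, h2]
      simp
  have h0 := h _ hdom
  rw [lp.inner_single_left, Submodule.coe_inner, L2.inner_def] at h0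
  have h1 : ∫ K, (w K)⁻¹ * ‖sector η n K‖ ^ 2 = 0 := by
    have : ∫ K, (((w K)⁻¹ * ‖sector η n K‖ ^ 2 : ℝ) : ℂ) = 0 := by
      rw [← h0]
      refine integral_congr_ae ?_
      filter_upwards [hc] with K hK
      rw [hK]
      change _ = inner ℂ _ (sector η n K)
      rw [RCLike.inner_apply, map_mul, map_inv₀, Complex.conj_ofReal, mul_left_comm,
        Complex.mul_conj, Complex.normSq_eq_norm_sq]
      push_cast
      ring
    rw [integral_complex_ofReal] at this
    exact_mod_cast this
  have hi : Integrable fun K => (w K)⁻¹ * ‖sector η n K‖ ^ 2 := by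
    refine hη.norm.integrable_sq.mono ?_ (Eventually.of_forall fun K => ?_)
    · exact hwc.measurable.inv.aestronglyMeasurable.mul hη.norm.integrable_sq.1
    · rw [norm_mul, norm_inv, Real.norm_of_nonneg (by linarith [hw1 K] : 0 ≤ w K)]
      exact mul_le_of_le_one_left (norm_nonneg _) (inv_le_one_of_one_le₀ (hw1 K))
  rw [integral_eq_zero_iff_of_nonneg (fun K => mul_nonneg
    (inv_nonneg.2 (by linarith [hw1 K])) (sq_nonneg _)) hi] at h1
  filter_upwards [h1] with K hK
  have h2 : (w K)⁻¹ ≠ 0 := inv_ne_zero (by linarith [hw1 K])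
  simpa [h2] using hK

/-- The graph is single-valued. -/
theorem fiberGraph_functional (α : ℝ) (P : R3) (x : Fock × Fock)
    (hx : x ∈ fiberGraph α P) (h0 : x.1 = 0) : x.2 = 0 := by
  obtain ⟨Ψ, η⟩ := x
  obtain rfl : Ψ = 0 := h0
  refine eq_zero_of_orthogonal_formDomain P η fun Φ hΦ => ?_
  have h := (hx.2 Φ hΦ).2.unique (HasForm.zero_right α P Φ).2
  simpa using h

/-- The fiber Hamiltonian `H(P) = (P - P_f)² + N + √α φ(v)`: the operator such that `H(P) + 1` is
associated with the quadratic form `Q_P` on `D(H₀^{1/2})`. -/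
def fiberHamiltonian (α : ℝ) (P : R3) : Fock →ₗ.[ℂ] Fock := (fiberGraph α P).toLinearPMap

theorem fiberHamiltonian_graph (α : ℝ) (P : R3) :
    (fiberHamiltonian α P).graph = fiberGraph α P :=
  Submodule.toLinearPMap_graph_eq _ (fiberGraph_functional α P)

/-! ### Norm-resolvent convergence -/

/-- `R` is the bounded inverse of `A - z`, i.e. `z` is in the resolvent set of `A` and
`R = (A - z)⁻¹`. -/
def IsResolventAt (A : Fock →ₗ.[ℂ] Fock) (z : ℂ) (R : Fock →L[ℂ] Fock) : Prop :=
  ∀ Ψ Φ : Fock, R Φ = Ψ ↔ ∃ h : Ψ ∈ A.domain, A ⟨Ψ, h⟩ - z • Ψ = Φ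

/-- The operators `A i x` converge along `l` to `B x` in norm-resolvent sense, uniformly in the
parameter `x`: for every non-real `z`, the resolvents `(A i x - z)⁻¹` converge to `(B x - z)⁻¹` in
operator norm, uniformly in `x`. -/
def NormResolventTendstoUniformly {ι X : Type*} (l : Filter ι) (A : ι → X → Fock →ₗ.[ℂ] Fock)
    (B : X → Fock →ₗ.[ℂ] Fock) : Prop :=
  ∀ z : ℂ, z.im ≠ 0 → ∃ (RA : ι → X → Fock →L[ℂ] Fock) (RB : X → Fock →L[ℂ] Fock),
    (∀ᶠ i in l, ∀ x, IsResolventAt (A i x) z (RA i x)) ∧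
    (∀ x, IsResolventAt (B x) z (RB x)) ∧ TendstoUniformly RA RB l

end Polaron

end

/-!
Conjugate with the bounded operator `T = H₀^{-1/2}`. The form of `H(P) + 1` on `D(H₀^{1/2})` then
becomes the bounded form of `1 + B` with `B = √α (U + U*)` and `U = T a*(v) T`. By the triangle
inequality, `(n + 1)(1 + |k|²)` is at most twice the product of the symbols of `H₀` before and after
the phonon `k` is created, so only the norm of `(1 + |k|²)^{-1/2} v` in `L²` enters the bound on
`U`. This norm is finite although `v` is not square integrable, and the corresponding norm of
`v_Λ - v` controls `U_Λ - U` uniformly in `P`. The resolvent is recovered as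
`(H - z)⁻¹ = T (1 + B - (1 + z) T²)⁻¹ T`.

With a cutoff, `a*(v_Λ) T` and `a(v_Λ) T` are bounded, so that `B_Λ = T C_Λ`. This gives the domain
`D(H₀)` and, by Cauchy-Schwarz, a lower bound for the form of `1 + B_Λ` modulo `T²`. As `B` is close
to `B_Λ` in norm for large `Λ`, the lower bound passes to `B` and makes the inverses above bounded
uniformly in `Λ` and `P`.
-/

open scoped NNReal ENNReal

noncomputable section

namespace Polaron

/-! ### Resolvents of unbounded operators -/

section Resolvent

variable {𝕜 H : Type*} [RCLike 𝕜] [NormedAddCommGroup H] [InnerProductSpace 𝕜 H]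

/-- `z` lies in the resolvent set of the unbounded operator `A`, and `R = (A - z)⁻¹`. Phrased
through the graph, so that no domain appears. -/
def HasResolvent (A : H →ₗ.[𝕜] H) (z : 𝕜) (R : H →L[𝕜] H) : Prop :=
  ∀ x y : H, (x, y) ∈ A.graph ↔ R (y - z • x) = x

namespace HasResolvent

variable {A : H →ₗ.[𝕜] H} {z : 𝕜} {R : H →L[𝕜] H}

theorem mem_graph (hR : HasResolvent A z R) (u : H) : (R u, u + z • R u) ∈ A.graph := by
  rw [hR, add_sub_cancel_right]

theorem mem_domain (hR : HasResolvent A z R) (u : H) : R u ∈ A.domain :=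
  LinearPMap.mem_domain_of_mem_graph (hR.mem_graph u)

theorem eq_zero_of_apply_eq_zero (hR : HasResolvent A z R) {u : H} (hu : R u = 0) : u = 0 := by
  have h := hR.mem_graph u
  rw [hu, smul_zero, add_zero] at h
  exact A.graph_fst_eq_zero_snd h rfl

variable [CompleteSpace H]

theorem dense_domain (hR : HasResolvent A z R) {w : 𝕜} (hR' : HasResolvent A w R.adjoint) :
    Dense (A.domain : Set H) := by
  rw [Submodule.dense_iff_topologicalClosure_eq_top, Submodule.topologicalClosure_eq_top_iff,
    Submodule.eq_bot_iff]
  intro u hu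
  refine hR'.eq_zero_of_apply_eq_zero (ext_inner_left 𝕜 fun v => ?_)
  rw [ContinuousLinearMap.adjoint_inner_right, inner_zero_right]
  exact (Submodule.mem_orthogonal _ _).1 hu _ (hR.mem_domain v)

theorem isSelfAdjoint (hR : HasResolvent A z R) (hR' : HasResolvent A (conj z) R.adjoint) :
    IsSelfAdjoint A := by
  rw [LinearPMap.isSelfAdjoint_def]
  refine LinearPMap.eq_of_eq_graph ?_
  rw [LinearPMap.adjoint_graph_eq_graph_adjoint (hR.dense_domain hR')]
  ext ⟨y, w⟩
  have pairing (u : H) : inner 𝕜 (u + z • R u) y - inner 𝕜 (R u) w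
      = inner 𝕜 u (y - R.adjoint (w - conj z • y)) := by
    rw [inner_add_left, inner_smul_left, inner_sub_right, ContinuousLinearMap.adjoint_inner_right,
      inner_sub_right, inner_smul_right]
    ring
  rw [hR', Submodule.mem_adjoint_iff]
  constructor
  · intro hy
    have h := hy _ _ (hR.mem_graph (y - R.adjoint (w - conj z • y)))
    rw [pairing, inner_self_eq_zero, sub_eq_zero] at h
    exact h.symm
  · intro hy a b hab
    have h := pairing (b - z • a)
    rwa [(hR a b).1 hab, hy, sub_self, inner_zero_right, sub_add_cancel] at h

end HasResolvent

theorem HasResolvent.isResolventAt {A : Fock →ₗ.[ℂ] Fock} {z : ℂ} {R : Fock →L[ℂ] Fock}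
    (hR : HasResolvent A z R) : IsResolventAt A z R := by
  intro Ψ Φ
  have h := hR Ψ (Φ + z • Ψ)
  rw [add_sub_cancel_right] at h
  rw [← h]
  simp only [LinearPMap.mem_graph_iff, Subtype.exists, exists_and_left, exists_eq_left,
    sub_eq_iff_eq_add]

end Resolvent

section Coercive

variable {𝕜 H : Type*} [RCLike 𝕜] [NormedAddCommGroup H] [InnerProductSpace 𝕜 H] [CompleteSpace H]
  {G G' : H →L[𝕜] H} {c : ℝ}

theorem isUnit_of_le_norm_inner (hc : 0 < c) (hG : ∀ x, c * ‖x‖ ^ 2 ≤ ‖inner 𝕜 x (G x)‖) :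
    IsUnit G := by
  refine ContinuousLinearMap.isUnit_of_forall_le_norm_inner_map G (c := ⟨c, hc.le⟩) hc fun x => ?_
  rw [← inner_conj_symm, RCLike.norm_conj, mul_comm]
  exact hG x

theorem norm_inverse_le_of_le_norm_inner (hc : 0 < c)
    (hG : ∀ x, c * ‖x‖ ^ 2 ≤ ‖inner 𝕜 x (G x)‖) : ‖Ring.inverse G‖ ≤ c⁻¹ := by
  refine ContinuousLinearMap.opNorm_le_bound _ (by positivity) fun x => ?_
  set y := Ring.inverse G x
  have hy : G y = x :=
    congrArg (fun S : H →L[𝕜] H => S x) (Ring.mul_inverse_cancel _ (isUnit_of_le_norm_inner hc hG))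
  have hcy : c * ‖y‖ ^ 2 ≤ ‖y‖ * ‖x‖ := hy ▸ (hG y).trans (norm_inner_le_norm _ _)
  rw [inv_mul_eq_div, le_div_iff₀ hc]
  rcases (norm_nonneg y).eq_or_lt with h | h
  · rw [← h, zero_mul]
    exact norm_nonneg x
  · nlinarith

theorem norm_inverse_sub_inverse_le (hc : 0 < c) (hG : ∀ x, c * ‖x‖ ^ 2 ≤ ‖inner 𝕜 x (G x)‖)
    (hG' : ∀ x, c * ‖x‖ ^ 2 ≤ ‖inner 𝕜 x (G' x)‖) :
    ‖Ring.inverse G - Ring.inverse G'‖ ≤ c⁻¹ ^ 2 * ‖G - G'‖ := by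
  rw [Ring.inverse_sub_inverse ⟨fun _ => isUnit_of_le_norm_inner hc hG',
    fun _ => isUnit_of_le_norm_inner hc hG⟩, norm_sub_rev G]
  calc ‖Ring.inverse G * (G' - G) * Ring.inverse G'‖
      ≤ ‖Ring.inverse G‖ * ‖G' - G‖ * ‖Ring.inverse G'‖ := norm_mul₃_le
    _ ≤ c⁻¹ * ‖G' - G‖ * c⁻¹ := by
        gcongr
        · exact norm_inverse_le_of_le_norm_inner hc hG
        · exact norm_inverse_le_of_le_norm_inner hc hG'
    _ = c⁻¹ ^ 2 * ‖G' - G‖ := by ring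

end Coercive

/-! ### Form sums `T⁻¹ (1 + B) T⁻¹ - 1` -/

section FormSum

variable {H : Type*} [NormedAddCommGroup H] [InnerProductSpace ℂ H]
  {T B B' C : H →L[ℂ] H} {A : H →ₗ.[ℂ] H} {z : ℂ} {c e M : ℝ}

/-- `A = T⁻¹ (1 + B) T⁻¹ - 1`: with `T = H₀^{-1/2}`, this says that `A + 1` is the form sum of `H₀`
and the perturbation whose form is `⟨H₀^{1/2} Φ, B H₀^{1/2} Ψ⟩`. -/
def IsFormSum (T B : H →L[ℂ] H) (A : H →ₗ.[ℂ] H) : Prop :=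
  ∀ Ψ η : H, (Ψ, η) ∈ A.graph ↔ ∃ y, T y = Ψ ∧ y + B y = T (η + Ψ)

/-- The bounded operator `1 + B - (1 + z) T²`, for which formally
`T⁻¹ (1 + B) T⁻¹ - 1 - z = T⁻¹ (pencil T B z) T⁻¹`. -/
def pencil (T B : H →L[ℂ] H) (z : ℂ) : H →L[ℂ] H := 1 + B - (1 + z) • (T * T)

/-- The candidate `T (pencil T B z)⁻¹ T` for the resolvent at `z` of a form sum; it is `0` if the
pencil is not invertible. -/
def formResolvent (T B : H →L[ℂ] H) (z : ℂ) : H →L[ℂ] H := T * Ring.inverse (pencil T B z) * T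

/-- The form of `1 + B` is bounded below by `c - M T²`, that is, the form sum is bounded below by
`c T⁻² - M - 1`. -/
def FormLowerBound (T B : H →L[ℂ] H) (c M : ℝ) : Prop :=
  ∀ x : H, c * ‖x‖ ^ 2 ≤ RCLike.re (inner ℂ x (x + B x)) + M * ‖T x‖ ^ 2

theorem pencil_apply (x : H) : pencil T B z x = x + B x - (1 + z) • T (T x) := rfl

theorem exists_form_eq_iff_of_factor (hB : ∀ x, B x = T (C x)) (Ψ η : H) :
    (∃ y, T y = Ψ ∧ y + B y = T (η + Ψ)) ↔ ∃ x, T (T x) = Ψ ∧ η + Ψ = x + C (T x) := by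
  constructor
  · rintro ⟨y, hy, h⟩
    have hx : T (η + Ψ - C y) = y := by rw [map_sub, ← hB, ← h, add_sub_cancel_right]
    exact ⟨η + Ψ - C y, by rw [hx, hy], by rw [hx, sub_add_cancel]⟩
  · rintro ⟨x, hx, h⟩
    exact ⟨T x, hx, by rw [hB, h, map_add]⟩

theorem IsFormSum.hasResolvent (hA : IsFormSum T B A) (hu : IsUnit (pencil T B z)) :
    HasResolvent A z (formResolvent T B z) := by
  intro Ψ η
  have solve {y : H} (hy : T y = Ψ) :
      y + B y = T (η + Ψ) ↔ pencil T B z y = T (η - z • Ψ) := by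
    rw [pencil_apply, hy, map_add, map_sub, map_smul, sub_eq_iff_eq_add]
    exact Eq.congr_right (by module)
  rw [hA]
  constructor
  · rintro ⟨y, hy, h⟩
    change T (Ring.inverse (pencil T B z) (T (η - z • Ψ))) = Ψ
    rw [← (solve hy).1 h, ← mul_apply_eq_comp (Ring.inverse _), Ring.inverse_mul_cancel _ hu,
      one_apply_eq_self, hy]
  · intro h
    refine ⟨Ring.inverse (pencil T B z) (T (η - z • Ψ)), h, (solve h).2 ?_⟩
    exact congrArg (fun S : H →L[ℂ] H => S (T (η - z • Ψ))) (Ring.mul_inverse_cancel _ hu)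

namespace FormLowerBound

theorem perturb (h : FormLowerBound T B c M) (hB : ‖B' - B‖ ≤ e) :
    FormLowerBound T B' (c - e) M := by
  intro x
  have hsplit : x + B' x = x + B x + (B' - B) x := by rw [sub_apply]; abel
  have hsmall : ‖inner ℂ x ((B' - B) x)‖ ≤ e * ‖x‖ ^ 2 := by
    refine (norm_inner_le_norm _ _).trans ?_
    nlinarith [(B' - B).le_of_opNorm_le hB x, norm_nonneg x]
  have hre := (abs_le.1 ((RCLike.abs_re_le_norm _).trans hsmall)).1
  rw [hsplit, inner_add_right, map_add]
  linarith [h x]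

variable [CompleteSpace H]

theorem of_factor (hT : IsSelfAdjoint T) (hC : ‖C‖ ≤ M) :
    FormLowerBound T (T * C) (3 / 4) (M ^ 2) := by
  intro x
  have hform : inner ℂ x ((T * C) x) = inner ℂ (T x) (C x) := (hT.isSymmetric x (C x)).symm
  have hcs : ‖inner ℂ (T x) (C x)‖ ≤ ‖T x‖ * (M * ‖x‖) :=
    (norm_inner_le_norm _ _).trans (by gcongr; exact C.le_of_opNorm_le hC x)
  have hre := (abs_le.1 ((RCLike.abs_re_le_norm _).trans hcs)).1
  rw [inner_add_right, map_add, inner_self_eq_norm_sq, hform]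
  nlinarith [sq_nonneg (‖x‖ / 2 - M * ‖T x‖)]

theorem le_norm_inner_pencil (h : FormLowerBound T B c M) (hT : IsSelfAdjoint T)
    (hB : IsSelfAdjoint B) (hz : z.im ≠ 0) (x : H) :
    c * |z.im| / (|z.im| + |M + 1 + z.re|) * ‖x‖ ^ 2 ≤ ‖inner ℂ x (pencil T B z x)‖ := by
  set a := (inner ℂ x (x + B x)).re
  have ha : inner ℂ x (x + B x) = (a : ℂ) :=
    (((IsSelfAdjoint.one (H →L[ℂ] H)).add hB).isSymmetric.coe_re_inner_self_apply x).symm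
  have hTT : inner ℂ x (T (T x)) = ((‖T x‖ ^ 2 : ℝ) : ℂ) :=
    (hT.isSymmetric x (T x)).symm.trans (by simp [inner_self_eq_norm_sq_to_K])
  have hpencil : inner ℂ x (pencil T B z x) = a - (1 + z) * (‖T x‖ ^ 2 : ℝ) := by
    rw [pencil_apply, inner_sub_right, inner_smul_right, ha, hTT]
  have hre : a - (1 + z.re) * ‖T x‖ ^ 2 ≤ ‖inner ℂ x (pencil T B z x)‖ := by
    refine le_trans (le_of_eq ?_) (Complex.re_le_norm _)
    rw [hpencil, Complex.sub_re, Complex.re_mul_ofReal, Complex.ofReal_re, Complex.add_re,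
      Complex.one_re]
  have him : |z.im| * ‖T x‖ ^ 2 ≤ ‖inner ℂ x (pencil T B z x)‖ := by
    refine le_trans (le_of_eq ?_) (Complex.abs_im_le_norm _)
    rw [hpencil, Complex.sub_im, Complex.im_mul_ofReal, Complex.ofReal_im, Complex.add_im,
      Complex.one_im, zero_add, zero_sub, abs_neg, abs_mul, abs_of_nonneg (sq_nonneg ‖T x‖)]
  have hz' : 0 < |z.im| := abs_pos.2 hz
  have hlow : c * ‖x‖ ^ 2 ≤ a + M * ‖T x‖ ^ 2 := h x
  rw [div_mul_eq_mul_div, div_le_iff₀ (by positivity)]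
  nlinarith [mul_le_mul_of_nonneg_left hre hz'.le, mul_le_mul_of_nonneg_left hlow hz'.le,
    mul_le_mul_of_nonneg_left him (abs_nonneg (M + 1 + z.re)),
    mul_le_mul_of_nonneg_left (le_abs_self (M + 1 + z.re)) (mul_nonneg hz'.le (sq_nonneg ‖T x‖))]

theorem isUnit_pencil (h : FormLowerBound T B c M) (hc : 0 < c) (hT : IsSelfAdjoint T)
    (hB : IsSelfAdjoint B) (hz : z.im ≠ 0) : IsUnit (pencil T B z) :=
  isUnit_of_le_norm_inner (by have := abs_pos.2 hz; positivity) (h.le_norm_inner_pencil hT hB hz)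

end FormLowerBound

variable [CompleteSpace H]

theorem star_pencil (hT : IsSelfAdjoint T) (hB : IsSelfAdjoint B) (z : ℂ) :
    star (pencil T B z) = pencil T B (conj z) := by
  simp only [pencil, star_sub, star_add, star_one, star_smul, star_mul, hT.star_eq, hB.star_eq,
    Complex.star_def]

theorem adjoint_formResolvent (hT : IsSelfAdjoint T) (hB : IsSelfAdjoint B) (z : ℂ) :
    (formResolvent T B z).adjoint = formResolvent T B (conj z) := by
  rw [← ContinuousLinearMap.star_eq_adjoint, formResolvent, formResolvent, star_mul, star_mul,
    ← Ring.inverse_star, star_pencil hT hB, hT.star_eq, mul_assoc]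

theorem IsFormSum.isSelfAdjoint (hA : IsFormSum T B A) (hT : IsSelfAdjoint T)
    (hB : IsSelfAdjoint B) (hc : 0 < c) (h : FormLowerBound T B c M) : IsSelfAdjoint A := by
  have hR (w : ℂ) (hw : w.im ≠ 0) : HasResolvent A w (formResolvent T B w) :=
    hA.hasResolvent (h.isUnit_pencil hc hT hB hw)
  refine (hR Complex.I (by simp)).isSelfAdjoint ?_
  rw [adjoint_formResolvent hT hB]
  exact hR _ (by simp)

theorem norm_formResolvent_sub_le (hT : ‖T‖ ≤ 1) (hc : 0 < c)
    (h : ∀ x, c * ‖x‖ ^ 2 ≤ ‖inner ℂ x (pencil T B z x)‖)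
    (h' : ∀ x, c * ‖x‖ ^ 2 ≤ ‖inner ℂ x (pencil T B' z x)‖) :
    ‖formResolvent T B z - formResolvent T B' z‖ ≤ c⁻¹ ^ 2 * ‖B - B'‖ := by
  have hsub : pencil T B z - pencil T B' z = B - B' := by simp only [pencil]; abel
  calc ‖formResolvent T B z - formResolvent T B' z‖
      = ‖T * (Ring.inverse (pencil T B z) - Ring.inverse (pencil T B' z)) * T‖ := by
        rw [mul_sub, sub_mul, formResolvent, formResolvent]
    _ ≤ ‖T‖ * ‖Ring.inverse (pencil T B z) - Ring.inverse (pencil T B' z)‖ * ‖T‖ := norm_mul₃_le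
    _ ≤ 1 * (c⁻¹ ^ 2 * ‖B - B'‖) * 1 := by
        gcongr
        exact hsub ▸ norm_inverse_sub_inverse_le hc h h'
    _ = c⁻¹ ^ 2 * ‖B - B'‖ := by ring

variable {ι X : Type*} {l : Filter ι} {T : X → H →L[ℂ] H} {B : ι → X → H →L[ℂ] H}
  {B₀ : X → H →L[ℂ] H}

theorem tendstoUniformly_formResolvent (hT : ∀ x, IsSelfAdjoint (T x)) (hT1 : ∀ x, ‖T x‖ ≤ 1)
    (hB : ∀ i x, IsSelfAdjoint (B i x)) (hB₀ : ∀ x, IsSelfAdjoint (B₀ x)) (hc : 0 < c)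
    (h : ∀ᶠ i in l, ∀ x, FormLowerBound (T x) (B i x) c M)
    (h₀ : ∀ x, FormLowerBound (T x) (B₀ x) c M) (hlim : TendstoUniformly B B₀ l)
    (hz : z.im ≠ 0) :
    TendstoUniformly (fun i x => formResolvent (T x) (B i x) z)
      (fun x => formResolvent (T x) (B₀ x) z) l := by
  set d := c * |z.im| / (|z.im| + |M + 1 + z.re|)
  have hd : 0 < d := by have := abs_pos.2 hz; positivity
  rw [Metric.tendstoUniformly_iff] at hlim ⊢
  intro ε hε
  filter_upwards [h, hlim (d ^ 2 * ε) (by positivity)] with i hi hlim_i x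
  calc dist (formResolvent (T x) (B₀ x) z) (formResolvent (T x) (B i x) z)
      ≤ d⁻¹ ^ 2 * ‖B₀ x - B i x‖ := by
        rw [dist_eq_norm]
        exact norm_formResolvent_sub_le (hT1 x) hd
          ((h₀ x).le_norm_inner_pencil (hT x) (hB₀ x) hz)
          ((hi x).le_norm_inner_pencil (hT x) (hB i x) hz)
    _ < d⁻¹ ^ 2 * (d ^ 2 * ε) := by
        rw [← dist_eq_norm]
        gcongr
        exact hlim_i x
    _ = ε := by field_simp

theorem exists_formLowerBound_of_tendstoUniformly [l.NeBot] (hT : ∀ x, IsSelfAdjoint (T x))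
    (hB : ∀ᶠ i in l, ∃ M, ∀ x, ∃ C, ‖C‖ ≤ M ∧ B i x = T x * C) (hlim : TendstoUniformly B B₀ l) :
    ∃ M, (∀ᶠ i in l, ∀ x, FormLowerBound (T x) (B i x) (1 / 2) M) ∧
      ∀ x, FormLowerBound (T x) (B₀ x) (1 / 2) M := by
  have hclose : ∀ᶠ i in l, ∀ x, ‖B₀ x - B i x‖ ≤ 1 / 8 := by
    filter_upwards [Metric.tendstoUniformly_iff.1 hlim (1 / 8) (by norm_num)] with i hi x
    rw [← dist_eq_norm]
    exact (hi x).le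
  obtain ⟨j, hj, M, hM⟩ := (hclose.and hB).exists
  have hlow {D : H →L[ℂ] H} {x : X} (hD : ‖D - B j x‖ ≤ 1 / 4) :
      FormLowerBound (T x) D (1 / 2) (M ^ 2) := by
    obtain ⟨C, hC, hBC⟩ := hM x
    convert (FormLowerBound.of_factor (hT x) hC).perturb (hBC ▸ hD) using 1
    norm_num
  refine ⟨M ^ 2, ?_, fun x => hlow ((hj x).trans (by norm_num))⟩
  filter_upwards [hclose] with i hi x
  refine hlow ?_
  calc ‖B i x - B j x‖ ≤ ‖B i x - B₀ x‖ + ‖B₀ x - B j x‖ := norm_sub_le_norm_sub_add_norm_sub _ _ _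
    _ ≤ 1 / 8 + 1 / 8 := add_le_add ((norm_sub_rev _ _).trans_le (hi x)) (hj x)
    _ = 1 / 4 := by norm_num

end FormSum

/-! ### Operators on `ℓ^p` sums and between `L^p` spaces -/

section LpSum

variable {𝕜 : Type*} [NontriviallyNormedField 𝕜] {p : ℝ≥0∞} [Fact (1 ≤ p)]

theorem exists_lp_clm_of_injective {ι κ : Type*} {E : ι → Type*} {F : κ → Type*}
    [∀ i, NormedAddCommGroup (E i)] [∀ i, NormedSpace 𝕜 (E i)]
    [∀ j, NormedAddCommGroup (F j)] [∀ j, NormedSpace 𝕜 (F j)] (hp : p ≠ ∞) {e : ι → κ}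
    (he : e.Injective) (L : ∀ j, lp E p →ₗ[𝕜] F j) {C : ℝ} (hC : 0 ≤ C)
    (hL : ∀ x i, ‖L (e i) x‖ ≤ C * ‖x i‖) (hL0 : ∀ x, ∀ j ∉ Set.range e, L j x = 0) :
    ∃ T : lp E p →L[𝕜] lp F p, ‖T‖ ≤ C ∧ ∀ x j, T x j = L j x := by
  have hp0 : 0 < p.toReal := ENNReal.toReal_pos (zero_lt_one.trans_le Fact.out).ne' hp
  have hsum : ∀ x, ∃ s ≤ (C * ‖x‖) ^ p.toReal, HasSum (fun j => ‖L j x‖ ^ p.toReal) s := fun x => by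
    have hx := (lp.hasSum_norm hp0 x).mul_left (C ^ p.toReal)
    have hle : ∀ i, ‖L (e i) x‖ ^ p.toReal ≤ C ^ p.toReal * ‖x i‖ ^ p.toReal := fun i => by
      rw [← Real.mul_rpow hC (norm_nonneg _)]
      exact Real.rpow_le_rpow (norm_nonneg _) (hL x i) hp0.le
    have hs := Summable.of_nonneg_of_le (fun i => by positivity) hle hx.summable
    refine ⟨_, (hasSum_le hle hs.hasSum hx).trans_eq
      (Real.mul_rpow hC (norm_nonneg _)).symm, (he.hasSum_iff fun j hj => ?_).1 hs.hasSum⟩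
    rw [hL0 x j hj, norm_zero, Real.zero_rpow hp0.ne']
  have hmem : ∀ x, Memℓp (fun j => L j x) p := fun x =>
    let ⟨_, _, h⟩ := hsum x
    (memℓp_gen_iff hp0).2 h.summable
  let T₀ : lp E p →ₗ[𝕜] lp F p :=
    { toFun := fun x => ⟨fun j => L j x, hmem x⟩
      map_add' := fun x y => lp.ext (funext fun j => map_add (L j) x y)
      map_smul' := fun c x => lp.ext (funext fun j => map_smul (L j) c x) }
  have hb : ∀ x, ‖T₀ x‖ ≤ C * ‖x‖ := fun x =>
    let ⟨_, hs, h⟩ := hsum x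
    lp.norm_le_of_tsum_le hp0 (by positivity) (h.tsum_eq.trans_le hs)
  exact ⟨T₀.mkContinuous C hb, T₀.mkContinuous_norm_le hC hb, fun _ _ => rfl⟩

theorem exists_lp_map {ι : Type*} {E F : ι → Type*}
    [∀ i, NormedAddCommGroup (E i)] [∀ i, NormedSpace 𝕜 (E i)]
    [∀ i, NormedAddCommGroup (F i)] [∀ i, NormedSpace 𝕜 (F i)] (hp : p ≠ ∞)
    (L : ∀ i, E i →L[𝕜] F i) {C : ℝ} (hC : 0 ≤ C) (hL : ∀ i, ‖L i‖ ≤ C) :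
    ∃ T : lp E p →L[𝕜] lp F p, ‖T‖ ≤ C ∧ ∀ x i, T x i = L i (x i) :=
  exists_lp_clm_of_injective hp Function.injective_id
    (fun i => (L i).toLinearMap ∘ₗ lp.evalₗ (𝕜 := 𝕜) E p i) hC
    (fun x i => (L i).le_of_opNorm_le (hL i) (x i)) (by simp)

theorem exists_lp_shift {E F : ℕ → Type*}
    [∀ n, NormedAddCommGroup (E n)] [∀ n, NormedSpace 𝕜 (E n)]
    [∀ n, NormedAddCommGroup (F n)] [∀ n, NormedSpace 𝕜 (F n)] (hp : p ≠ ∞)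
    (L : ∀ n, E n →L[𝕜] F (n + 1)) {C : ℝ} (hC : 0 ≤ C) (hL : ∀ n, ‖L n‖ ≤ C) :
    ∃ T : lp E p →L[𝕜] lp F p,
      ‖T‖ ≤ C ∧ (∀ x, T x 0 = 0) ∧ ∀ x n, T x (n + 1) = L n (x n) := by
  let L' : ∀ n, lp E p →ₗ[𝕜] F n := fun n => Nat.casesOn n 0
    fun n => (L n).toLinearMap ∘ₗ lp.evalₗ (𝕜 := 𝕜) E p n
  obtain ⟨T, hT, h⟩ := exists_lp_clm_of_injective hp Nat.succ_injective L' hC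
    (fun x n => (L n).le_of_opNorm_le (hL n) (x n)) fun x n hn => by
      obtain rfl : n = 0 := by simpa [Nat.range_succ] using hn
      rfl
  exact ⟨T, hT, fun x => h x 0, fun x n => h x (n + 1)⟩

end LpSum

section WeightedComposition

variable {X Y 𝕜 E : Type*} [MeasurableSpace X] [MeasurableSpace Y] {μ : Measure X} {ν : Measure Y}
  [NontriviallyNormedField 𝕜] [NormedAddCommGroup E] [NormedSpace 𝕜 E]

theorem exists_Lp_smul_comp {p q : ℝ≥0∞} [Fact (1 ≤ p)] [Fact (1 ≤ q)] {m : Y → 𝕜} {s : Y → X}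
    (hm : AEStronglyMeasurable m ν) (hs : Measure.QuasiMeasurePreserving s ν μ) (C : ℝ≥0)
    (hC : ∀ φ : X → E, MemLp φ p μ →
      eLpNorm (fun y => m y • φ (s y)) q ν ≤ C * eLpNorm φ p μ) :
    ∃ L : Lp E p μ →L[𝕜] Lp E q ν, ‖L‖ ≤ C ∧ ∀ φ, L φ =ᵐ[ν] fun y => m y • φ (s y) := by
  have hbound : ∀ φ : Lp E p μ, C * eLpNorm φ p μ < ∞ := fun φ =>
    ENNReal.mul_lt_top ENNReal.coe_lt_top (Lp.eLpNorm_lt_top φ)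
  have hmem : ∀ φ : Lp E p μ, MemLp (fun y => m y • φ (s y)) q ν := fun φ =>
    ⟨hm.smul ((Lp.aestronglyMeasurable φ).comp_quasiMeasurePreserving hs),
      (hC φ (Lp.memLp φ)).trans_lt (hbound φ)⟩
  let L₀ : Lp E p μ →ₗ[𝕜] Lp E q ν :=
    { toFun := fun φ => (hmem φ).toLp
      map_add' := fun φ ψ => by
        rw [← MemLp.toLp_add]
        refine (MemLp.toLp_eq_toLp_iff _ _).2 ?_
        filter_upwards [hs.ae (Lp.coeFn_add φ ψ)] with y hy
        rw [hy, Pi.add_apply, smul_add, Pi.add_apply]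
      map_smul' := fun c φ => by
        rw [RingHom.id_apply, ← MemLp.toLp_const_smul]
        refine (MemLp.toLp_eq_toLp_iff _ _).2 ?_
        filter_upwards [hs.ae (Lp.coeFn_smul c φ)] with y hy
        rw [hy, Pi.smul_apply, smul_comm, Pi.smul_apply] }
  have hb : ∀ φ, ‖L₀ φ‖ ≤ C * ‖φ‖ := fun φ => by
    refine (Lp.norm_toLp _ (hmem φ)).trans_le ?_
    rw [Lp.norm_def, ← ENNReal.coe_toReal, ← ENNReal.toReal_mul]
    exact ENNReal.toReal_mono (hbound φ).ne (hC φ (Lp.memLp φ))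
  exact ⟨L₀.mkContinuous C hb, L₀.mkContinuous_norm_le C.2 hb, fun φ => (hmem φ).coeFn_toLp⟩

theorem eLpNorm_prod_smul [SFinite ν] {p : ℝ≥0∞} (hp0 : p ≠ 0) (hp : p ≠ ∞)
    {g : X → 𝕜} {φ : Y → E} (hg : AEStronglyMeasurable g μ) (hφ : AEStronglyMeasurable φ ν) :
    eLpNorm (fun y : X × Y => g y.1 • φ y.2) p (μ.prod ν) = eLpNorm g p μ * eLpNorm φ p ν := by
  have h := lintegral_prod_mul (hg.enorm.pow_const p.toReal) (hφ.enorm.pow_const p.toReal)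
  simp only [eLpNorm_eq_lintegral_rpow_enorm_toReal hp0 hp, enorm_smul,
    ENNReal.mul_rpow_of_nonneg _ _ ENNReal.toReal_nonneg, h]
  exact ENNReal.mul_rpow_of_nonneg _ _ (by positivity)

end WeightedComposition

theorem integral_comp_of_measurePreserving {X Y E : Type*} [MeasurableSpace X] [MeasurableSpace Y]
    {μ : Measure X} {ν : Measure Y} [NormedAddCommGroup E] [NormedSpace ℝ E] {s : X → Y}
    (hs : MeasurePreserving s μ ν) {g : Y → E} (hg : AEStronglyMeasurable g ν) :
    ∫ x, g (s x) ∂μ = ∫ y, g y ∂ν := by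
  rw [← hs.map_eq] at hg ⊢
  exact (integral_map hs.measurable.aemeasurable hg).symm

section Slices

variable {X Y 𝕜 E : Type*} [MeasurableSpace X] [MeasurableSpace Y] {μ : Measure X} {ν : Measure Y}
  [SFinite μ] [SFinite ν] [NontriviallyNormedField 𝕜] [NormedAddCommGroup E] [NormedSpace 𝕜 E]
  {p q : ℝ≥0∞} {F : X × Y → E}

theorem lintegral_eLpNorm_slice (hp0 : p ≠ 0) (hp : p ≠ ∞)
    (hF : AEStronglyMeasurable F (μ.prod ν)) :
    ∫⁻ y, eLpNorm (fun x => F (x, y)) p μ ^ p.toReal ∂ν =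
      eLpNorm F p (μ.prod ν) ^ p.toReal := by
  have hp' := (ENNReal.toReal_pos hp0 hp).ne'
  simp only [eLpNorm_eq_lintegral_rpow_enorm_toReal hp0 hp, one_div, ENNReal.rpow_inv_rpow hp']
  exact (lintegral_prod_symm _ (hF.enorm.pow_const _)).symm

theorem ae_memLp_slice (hp0 : p ≠ 0) (hp : p ≠ ∞) (hF : MemLp F p (μ.prod ν)) :
    ∀ᵐ y ∂ν, MemLp (fun x => F (x, y)) p μ := by
  have hp' := ENNReal.toReal_pos hp0 hp
  have hm : AEMeasurable (fun y => eLpNorm (fun x => F (x, y)) p μ ^ p.toReal) ν := by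
    simp only [eLpNorm_eq_lintegral_rpow_enorm_toReal hp0 hp, one_div,
      ENNReal.rpow_inv_rpow hp'.ne']
    exact (hF.1.enorm.pow_const _).prod_swap.lintegral_prod_right'
  have hfin : ∫⁻ y, eLpNorm (fun x => F (x, y)) p μ ^ p.toReal ∂ν ≠ ∞ := by
    rw [lintegral_eLpNorm_slice hp0 hp hF.1]
    exact ENNReal.rpow_ne_top_of_nonneg hp'.le hF.2.ne
  filter_upwards [hF.1.prodMk_right, ae_lt_top' hm hfin] with y hy hlt
  exact ⟨hy, (ENNReal.rpow_lt_top_iff_of_pos hp').1 hlt⟩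

theorem memLp_integral_smul_slice [NormedSpace ℝ E] [p.HolderTriple q 1] (hq0 : q ≠ 0) (hq : q ≠ ∞)
    {g : X → 𝕜} (hg : MemLp g p μ) (hF : MemLp F q (μ.prod ν)) :
    MemLp (fun y => ∫ x, g x • F (x, y) ∂μ) q ν := by
  have hq' := ENNReal.toReal_pos hq0 hq
  refine ⟨(hg.1.comp_fst.smul hF.1).prod_swap.integral_prod_right', ?_⟩
  have hbound : ∀ᵐ y ∂ν, ‖∫ x, g x • F (x, y) ∂μ‖ₑ ≤
      eLpNorm g p μ * eLpNorm (fun x => F (x, y)) q μ := by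
    filter_upwards [ae_memLp_slice hq0 hq hF] with y hy
    refine (enorm_integral_le_lintegral_enorm _).trans ?_
    rw [← eLpNorm_one_eq_lintegral_enorm]
    exact eLpNorm_smul_le_mul_eLpNorm hy.1 hg.1
  rw [eLpNorm_lt_top_iff_lintegral_rpow_enorm_lt_top hq0 hq]
  calc ∫⁻ y, ‖∫ x, g x • F (x, y) ∂μ‖ₑ ^ q.toReal ∂ν
      ≤ ∫⁻ y, (eLpNorm g p μ * eLpNorm (fun x => F (x, y)) q μ) ^ q.toReal ∂ν := by
        refine lintegral_mono_ae (hbound.mono fun y hy => ?_)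
        gcongr
    _ = eLpNorm g p μ ^ q.toReal * eLpNorm F q (μ.prod ν) ^ q.toReal := by
        simp only [ENNReal.mul_rpow_of_nonneg _ _ hq'.le]
        rw [lintegral_const_mul' _ _ (ENNReal.rpow_ne_top_of_nonneg hq'.le hg.2.ne),
          lintegral_eLpNorm_slice hq0 hq hF.1]
    _ < ∞ := ENNReal.mul_lt_top (ENNReal.rpow_lt_top_of_nonneg hq'.le hg.2.ne)
        (ENNReal.rpow_lt_top_of_nonneg hq'.le hF.2.ne)

end Slices

section HeadTail

variable {α 𝕜 E : Type*} [MeasureSpace α] [SigmaFinite (volume : Measure α)]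
  [NontriviallyNormedField 𝕜] [NormedAddCommGroup E] [NormedSpace 𝕜 E]

theorem measurePreserving_head_tail (n : ℕ) :
    MeasurePreserving (fun K : Fin (n + 1) → α => (K 0, Fin.tail K)) volume
      ((volume : Measure α).prod (volume : Measure (Fin n → α))) := by
  have h := volume_preserving_piFinSuccAbove (fun _ : Fin (n + 1) => α) 0
  have e : (MeasurableEquiv.piFinSuccAbove (fun _ : Fin (n + 1) => α) 0 :
      (Fin (n + 1) → α) → α × (Fin n → α)) = fun K => (K 0, Fin.tail K) := by
    funext K
    simp [MeasurableEquiv.piFinSuccAbove, Fin.insertNthEquiv]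
  rwa [e] at h

theorem quasiMeasurePreserving_tail (n : ℕ) :
    Measure.QuasiMeasurePreserving (fun K : Fin (n + 1) → α => Fin.tail K) volume volume :=
  Measure.quasiMeasurePreserving_snd.comp (measurePreserving_head_tail n).quasiMeasurePreserving

theorem eLpNorm_head_smul_tail {p : ℝ≥0∞} (hp0 : p ≠ 0) (hp : p ≠ ∞) {n : ℕ} {g : α → 𝕜}
    {φ : (Fin n → α) → E} (hg : AEStronglyMeasurable g) (hφ : AEStronglyMeasurable φ) :
    eLpNorm (fun K : Fin (n + 1) → α => g (K 0) • φ (Fin.tail K)) p =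
      eLpNorm g p * eLpNorm φ p := by
  have h : AEStronglyMeasurable (fun y : α × (Fin n → α) => g y.1 • φ y.2)
      ((volume : Measure α).prod volume) := hg.comp_fst.smul hφ.comp_snd
  rw [← eLpNorm_prod_smul hp0 hp hg hφ,
    ← eLpNorm_comp_measurePreserving h (measurePreserving_head_tail n)]
  rfl

theorem measurePreserving_cons (n : ℕ) :
    MeasurePreserving (fun y : α × (Fin n → α) => (Fin.cons y.1 y.2 : Fin (n + 1) → α))
      ((volume : Measure α).prod (volume : Measure (Fin n → α))) volume := by
  have h := (volume_preserving_piFinSuccAbove (fun _ : Fin (n + 1) => α) 0).symm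
  have e : ((MeasurableEquiv.piFinSuccAbove (fun _ : Fin (n + 1) => α) 0).symm :
      α × (Fin n → α) → (Fin (n + 1) → α)) = fun y => Fin.cons y.1 y.2 := by
    funext y
    simp [MeasurableEquiv.piFinSuccAbove, Fin.insertNthEquiv, Fin.insertNth_zero']
  rwa [e] at h

theorem memLp_head_smul_tail {p : ℝ≥0∞} (hp0 : p ≠ 0) (hp : p ≠ ∞) {n : ℕ} {g : α → 𝕜}
    {φ : (Fin n → α) → E} (hg : MemLp g p) (hφ : MemLp φ p) :
    MemLp (fun K : Fin (n + 1) → α => g (K 0) • φ (Fin.tail K)) p := by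
  refine ⟨?_, ?_⟩
  · exact (hg.1.comp_fst.smul hφ.1.comp_snd).comp_measurePreserving (measurePreserving_head_tail n)
  · rw [eLpNorm_head_smul_tail hp0 hp hg.1 hφ.1]
    exact ENNReal.mul_lt_top hg.2 hφ.2

end HeadTail

/-! ### Multiplication and raising operators on Fock space -/

theorem memLp_sector (Ψ : Fock) (n : ℕ) : MemLp (sector Ψ n) 2 := Lp.memLp _

theorem L2n_inner_eq {n : ℕ} (φ ψ : L2n n) : inner ℂ φ ψ = ∫ K, conj (φ K) * ψ K := by
  simp only [L2.inner_def, RCLike.inner_apply']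

theorem hasSum_inner_sector (Φ Ψ : Fock) :
    HasSum (fun n => ∫ K, conj (sector Φ n K) * sector Ψ n K) (inner ℂ Φ Ψ) := by
  have h := lp.hasSum_inner (𝕜 := ℂ) Φ Ψ
  simp only [Submodule.coe_inner, L2n_inner_eq] at h
  exact h

theorem exists_symL2_mul {n : ℕ} {w : (Fin n → R3) → ℂ} {C : ℝ≥0} (hm : Measurable w)
    (hw : ∀ K, ‖w K‖ ≤ C) (hσ : ∀ K (σ : Equiv.Perm (Fin n)), w (K ∘ σ) = w K) :
    ∃ L : symL2 n →L[ℂ] symL2 n, ‖L‖ ≤ C ∧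
      ∀ φ, (L φ : L2n n) =ᵐ[volume] fun K => w K * (φ : L2n n) K := by
  obtain ⟨L, hL, hLw⟩ := exists_Lp_smul_comp (E := ℂ) (p := 2) (q := 2)
    hm.aestronglyMeasurable (Measure.QuasiMeasurePreserving.id volume) C fun φ _ =>
      eLpNorm_le_nnreal_smul_eLpNorm_of_ae_le_mul (Eventually.of_forall fun K =>
        (norm_mul_le (w K) (φ K)).trans (mul_le_mul_of_nonneg_right (hw K) (norm_nonneg _))) 2
  have hsym : ∀ φ : symL2 n, L φ ∈ symL2 n := fun φ σ => by
    filter_upwards [hLw φ, φ.2 σ,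
      (measurePreserving_perm n σ).quasiMeasurePreserving.ae (hLw φ)] with K h1 h2 h3
    simp only [h3, h1, hσ, id_eq, h2]
  exact ⟨(L.comp (symL2 n).subtypeL).codRestrict (symL2 n) hsym,
    ContinuousLinearMap.opNorm_le_bound _ C.2 fun φ => L.le_of_opNorm_le hL φ, fun φ => hLw φ⟩

theorem exists_mulOperator {w : ∀ n, (Fin n → R3) → ℂ} {C : ℝ≥0} (hm : ∀ n, Measurable (w n))
    (hw : ∀ n K, ‖w n K‖ ≤ C) (hσ : ∀ n K (σ : Equiv.Perm (Fin n)), w n (K ∘ σ) = w n K) :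
    ∃ T : Fock →L[ℂ] Fock, ‖T‖ ≤ C ∧
      ∀ Ψ n, sector (T Ψ) n =ᵐ[volume] fun K => w n K * sector Ψ n K := by
  choose L hL hLw using fun n => exists_symL2_mul (hm n) (hw n) (hσ n)
  obtain ⟨T, hT, h⟩ := exists_lp_map (p := 2) (E := fun n => symL2 n) (F := fun n => symL2 n)
    ENNReal.ofNat_ne_top L C.2 hL
  refine ⟨T, hT, fun Ψ n => ?_⟩
  simp only [sector, h]
  exact hLw n (Ψ n)

theorem isSelfAdjoint_of_sector_eq_ofReal_mul {T : Fock →L[ℂ] Fock}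
    {w : ∀ n, (Fin n → R3) → ℝ}
    (h : ∀ Ψ n, sector (T Ψ) n =ᵐ[volume] fun K => (w n K : ℂ) * sector Ψ n K) :
    IsSelfAdjoint T := by
  rw [ContinuousLinearMap.isSelfAdjoint_iff_isSymmetric]
  intro Φ Ψ
  refine (hasSum_inner_sector (T Φ) Ψ).unique ?_
  convert! hasSum_inner_sector Φ (T Ψ) using 2 with n
  refine integral_congr_ae ?_
  filter_upwards [h Φ n, h Ψ n] with K h1 h2
  rw [h1, h2, map_mul, Complex.conj_ofReal]
  ring

theorem exists_L2n_raising {n : ℕ} {m : (Fin (n + 1) → R3) → ℂ} (hm : Measurable m)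
    {g : R3 → ℂ} (hg : MemLp g 2) (hmg : ∀ K, ‖m K‖ ≤ ‖g (K 0)‖) :
    ∃ L : L2n n →L[ℂ] L2n (n + 1), ‖L‖ ≤ (eLpNorm g 2).toReal ∧
      ∀ φ, L φ =ᵐ[volume] fun K => m K * φ (Fin.tail K) := by
  have hC : ∀ φ : (Fin n → R3) → ℂ, MemLp φ 2 →
      eLpNorm (fun K => m K • φ (Fin.tail K)) 2 ≤ (eLpNorm g 2).toNNReal * eLpNorm φ 2 := by
    intro φ hφ
    rw [ENNReal.coe_toNNReal hg.2.ne,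
      ← eLpNorm_head_smul_tail two_ne_zero ENNReal.ofNat_ne_top hg.1 hφ.1]
    refine eLpNorm_mono fun K => ?_
    rw [norm_smul, norm_smul]
    exact mul_le_mul_of_nonneg_right (hmg K) (norm_nonneg _)
  exact exists_Lp_smul_comp hm.aestronglyMeasurable (quasiMeasurePreserving_tail n) _ hC

theorem exists_symL2_raising {n : ℕ} {m : (Fin (n + 1) → R3) → ℂ} (hm : Measurable m)
    {g : R3 → ℂ} (hg : MemLp g 2) (hmg : ∀ K, ‖m K‖ ≤ ‖g (K 0)‖) :
    ∃ L : symL2 n →L[ℂ] symL2 (n + 1), ‖L‖ ≤ (eLpNorm g 2).toReal ∧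
      ∀ (χ : symL2 (n + 1)) (φ : symL2 n),
        (Integrable fun K => conj ((χ : L2n (n + 1)) K) * (m K * (φ : L2n n) (Fin.tail K))) ∧
        ∫ K, conj ((χ : L2n (n + 1)) K) * (m K * (φ : L2n n) (Fin.tail K)) =
          inner ℂ χ (L φ) := by
  obtain ⟨L, hL, hLm⟩ := exists_L2n_raising hm hg hmg
  refine ⟨(symL2 (n + 1)).orthogonalProjectionOnto.comp (L.comp (symL2 n).subtypeL),
    ContinuousLinearMap.opNorm_le_bound _ ENNReal.toReal_nonneg fun φ =>
      ((symL2 (n + 1)).norm_orthogonalProjectionOnto_apply_le _).trans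
        (L.le_of_opNorm_le hL φ), fun χ φ => ?_⟩
  have he : (fun K => conj ((χ : L2n (n + 1)) K) * L φ K) =ᵐ[volume]
      fun K => conj ((χ : L2n (n + 1)) K) * (m K * (φ : L2n n) (Fin.tail K)) := by
    filter_upwards [hLm φ] with K hK
    rw [hK]
  constructor
  · exact ((Lp.memLp (χ : L2n (n + 1))).star.integrable_mul (Lp.memLp (L φ))).congr he
  · rw [← integral_congr_ae he, ← L2n_inner_eq]
    exact (Submodule.inner_orthogonalProjectionOnto_eq_of_mem_left χ (L φ)).symm

/-- The integrand of `⟨Φ, UΨ⟩` on the `(n + 1)`-phonon sector, for the operator `U` that adds a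
phonon by multiplying with the kernel `m n`. -/
def raisingIntegrand (m : ∀ n, (Fin (n + 1) → R3) → ℂ) (Φ Ψ : Fock) (n : ℕ) :
    (Fin (n + 1) → R3) → ℂ :=
  fun K => conj (sector Φ (n + 1) K) * (m n K * sector Ψ n (Fin.tail K))

/-- `U` is the bounded operator that raises the phonon number by one with the kernel `m`. The new
momentum is put in front, and the result is symmetrized; testing against the (symmetric) vectors
of Fock space takes care of the symmetrization. -/
def IsRaising (m : ∀ n, (Fin (n + 1) → R3) → ℂ) (U : Fock →L[ℂ] Fock) : Prop :=
  ∀ Φ Ψ, (∀ n, Integrable (raisingIntegrand m Φ Ψ n)) ∧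
    HasSum (fun n => ∫ K, raisingIntegrand m Φ Ψ n K) (inner ℂ Φ (U Ψ))

theorem exists_isRaising {m : ∀ n, (Fin (n + 1) → R3) → ℂ} (hm : ∀ n, Measurable (m n))
    {g : R3 → ℂ} (hg : MemLp g 2) (hmg : ∀ n K, ‖m n K‖ ≤ ‖g (K 0)‖) :
    ∃ U : Fock →L[ℂ] Fock, ‖U‖ ≤ (eLpNorm g 2).toReal ∧ IsRaising m U := by
  choose L hL hLm using fun n => exists_symL2_raising (hm n) hg (hmg n)
  obtain ⟨U, hU, hU0, hUL⟩ :=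
    exists_lp_shift (p := 2) (E := fun n => symL2 n) (F := fun n => symL2 n) ENNReal.ofNat_ne_top
      L ENNReal.toReal_nonneg hL
  refine ⟨U, hU, fun Φ Ψ => ⟨fun n => (hLm n (Φ (n + 1)) (Ψ n)).1, ?_⟩⟩
  have h := lp.hasSum_inner (𝕜 := ℂ) Φ (U Ψ)
  rw [← hasSum_nat_add_iff' 1] at h
  simp only [Finset.range_one, Finset.sum_singleton, hU0, inner_zero_right, sub_zero, hUL,
    ← (hLm _ _ _).2] at h
  exact h

theorem IsRaising.ext {m : ∀ n, (Fin (n + 1) → R3) → ℂ} {U V : Fock →L[ℂ] Fock}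
    (hU : IsRaising m U) (hV : IsRaising m V) : U = V :=
  ContinuousLinearMap.ext fun Ψ => ext_inner_left ℂ fun Φ => (hU Φ Ψ).2.unique (hV Φ Ψ).2

theorem IsRaising.sub {m m' : ∀ n, (Fin (n + 1) → R3) → ℂ} {U V : Fock →L[ℂ] Fock}
    (hU : IsRaising m U) (hV : IsRaising m' V) : IsRaising (m - m') (U - V) := by
  intro Φ Ψ
  have e : ∀ n, raisingIntegrand (m - m') Φ Ψ n =
      raisingIntegrand m Φ Ψ n - raisingIntegrand m' Φ Ψ n := fun n => by
    funext K
    simp only [raisingIntegrand, Pi.sub_apply]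
    ring
  refine ⟨fun n => e n ▸ ((hU Φ Ψ).1 n).sub ((hV Φ Ψ).1 n), ?_⟩
  simp only [e, integral_sub' ((hU Φ Ψ).1 _) ((hV Φ Ψ).1 _), sub_apply, inner_sub_right]
  exact (hU Φ Ψ).2.sub (hV Φ Ψ).2

/-! ### Form factors weighted with the decay of the kinetic energy -/

theorem tendsto_eLpNorm_zero_of_dominated {X E F ι : Type*} [MeasurableSpace X] {μ : Measure X}
    [NormedAddCommGroup E] [NormedAddCommGroup F] {l : Filter ι} [l.IsCountablyGenerated]
    {p : ℝ≥0∞} (hp0 : p ≠ 0) (hp : p ≠ ∞) {f : ι → X → E} {g : X → F}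
    (hf : ∀ᶠ i in l, AEStronglyMeasurable (f i) μ) (hg : MemLp g p μ)
    (hfg : ∀ᶠ i in l, ∀ᵐ x ∂μ, ‖f i x‖ ≤ ‖g x‖)
    (hlim : ∀ᵐ x ∂μ, Tendsto (fun i => f i x) l (𝓝 0)) :
    Tendsto (fun i => eLpNorm (f i) p μ) l (𝓝 0) := by
  have hp' : 0 < p.toReal := ENNReal.toReal_pos hp0 hp
  have hlintegral : Tendsto (fun i => ∫⁻ x, ‖f i x‖ₑ ^ p.toReal ∂μ) l (𝓝 (∫⁻ _, 0 ∂μ)) := by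
    refine tendsto_lintegral_filter_of_dominated_convergence' (fun x => ‖g x‖ₑ ^ p.toReal)
      (hf.mono fun i hi => hi.enorm.pow_const _) (hfg.mono fun i hi => hi.mono fun x hx =>
        ENNReal.rpow_le_rpow (enorm_le_iff_norm_le.2 hx) hp'.le)
      (lintegral_rpow_enorm_lt_top_of_eLpNorm_lt_top hp0 hp hg.2).ne (hlim.mono fun x hx => ?_)
    simpa [ENNReal.zero_rpow_of_pos hp'] using hx.enorm.ennrpow_const p.toReal
  simpa [eLpNorm_eq_lintegral_rpow_enorm_toReal hp0 hp, hp'] using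
    hlintegral.ennrpow_const (1 / p.toReal)

/-- `(1 + |k|²)^{-1/2} f(k)`, normalized by the factor `√2` of `coupling_weight_le`; it is this
function, not `f`, whose square integrability makes `H₀^{-1/2} a*(f) H₀^{-1/2}` bounded. -/
def weighted (f : R3 → ℂ) (k : R3) : ℂ :=
  ((Real.sqrt 2 / Real.sqrt (1 + ‖k‖ ^ 2) : ℝ) : ℂ) * f k

theorem measurable_weighted {f : R3 → ℂ} (hf : Measurable f) : Measurable (weighted f) := by
  unfold weighted
  fun_prop

theorem norm_weighted_le_norm_weighted {f g : R3 → ℂ} {k : R3} (h : ‖f k‖ ≤ ‖g k‖) :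
    ‖weighted f k‖ ≤ ‖weighted g k‖ := by
  rw [weighted, weighted, norm_mul, norm_mul]
  exact mul_le_mul_of_nonneg_left h (norm_nonneg _)

theorem measurable_vHat : Measurable vHat := by
  unfold vHat
  fun_prop

theorem measurable_vHatCut (Λ : ℝ) : Measurable (vHatCut Λ) :=
  measurable_vHat.indicator (measurableSet_lt measurable_norm measurable_const)

-- In polar coordinates the square norm is a multiple of `∫ (1 + r²)⁻¹ dr`.
theorem memLp_weighted_vHat : MemLp (weighted vHat) 2 := by
  rw [memLp_two_iff_integrable_sq_norm (measurable_weighted measurable_vHat).aestronglyMeasurable]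
  have hradial : (fun k : R3 => ‖weighted vHat k‖ ^ 2) =
      fun k => (fun r : ℝ => 2 / (1 + r ^ 2) * (1 / (4 * Real.pi * r)) ^ 2) ‖k‖ := by
    funext k
    simp only [weighted, vHat, norm_mul, Complex.norm_real, Real.norm_eq_abs, mul_pow, sq_abs,
      div_pow, Real.sq_sqrt zero_le_two, Real.sq_sqrt (by positivity : 0 ≤ 1 + ‖k‖ ^ 2)]
  rw [hradial]
  refine (integrable_fun_norm_addHaar (volume : Measure R3)
    (f := fun r : ℝ => 2 / (1 + r ^ 2) * (1 / (4 * Real.pi * r)) ^ 2)).2 ?_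
  have hi : IntegrableOn (fun r : ℝ => 2 / (4 * Real.pi) ^ 2 * (1 + r ^ 2)⁻¹) (Set.Ioi 0) :=
    (integrable_inv_one_add_sq.const_mul _).integrableOn
  refine hi.congr_fun (fun r hr => ?_) measurableSet_Ioi
  have hr0 : r ≠ 0 := ne_of_gt hr
  have h1 : 1 + r ^ 2 ≠ 0 := by positivity
  simp only [finrank_euclideanSpace, Fintype.card_fin, smul_eq_mul]
  field_simp

theorem norm_vHatCut_le (Λ : ℝ) (k : R3) :
    ‖vHatCut Λ k‖ ≤ Real.sqrt (1 + Λ ^ 2) * ‖weighted vHat k‖ := by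
  by_cases hk : k ∈ {k : R3 | ‖k‖ < Λ}
  · have h0 : (0 : ℝ) < Real.sqrt (1 + ‖k‖ ^ 2) := Real.sqrt_pos.2 (by positivity)
    have h1 : Real.sqrt (1 + ‖k‖ ^ 2) ≤ Real.sqrt (1 + Λ ^ 2) :=
      Real.sqrt_le_sqrt (by nlinarith [norm_nonneg k, show ‖k‖ < Λ from hk])
    rw [vHatCut, Set.indicator_of_mem hk, weighted, norm_mul, Complex.norm_real,
      Real.norm_of_nonneg (by positivity), ← mul_assoc]
    refine le_mul_of_one_le_left (norm_nonneg _) ?_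
    rw [mul_div_assoc', le_div_iff₀ h0]
    nlinarith [Real.one_le_sqrt.2 one_le_two]
  · rw [vHatCut, Set.indicator_of_notMem hk, norm_zero]
    positivity

theorem memLp_vHatCut (Λ : ℝ) : MemLp (vHatCut Λ) 2 :=
  memLp_weighted_vHat.of_le_mul (measurable_vHatCut Λ).aestronglyMeasurable
    (Eventually.of_forall (norm_vHatCut_le Λ))

theorem norm_weighted_vHat_sub_vHatCut_le (Λ : ℝ) (k : R3) :
    ‖weighted (vHat - vHatCut Λ) k‖ ≤ ‖weighted vHat k‖ := by
  refine norm_weighted_le_norm_weighted ?_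
  by_cases hk : k ∈ {k : R3 | ‖k‖ < Λ}
  · simp [vHatCut, Set.indicator_of_mem hk]
  · simp [vHatCut, Set.indicator_of_notMem hk]

theorem memLp_weighted_vHat_sub_vHatCut (Λ : ℝ) : MemLp (weighted (vHat - vHatCut Λ)) 2 :=
  memLp_weighted_vHat.mono
    (measurable_weighted (measurable_vHat.sub (measurable_vHatCut Λ))).aestronglyMeasurable
    (Eventually.of_forall (norm_weighted_vHat_sub_vHatCut_le Λ))

theorem tendsto_eLpNorm_weighted_vHat_sub_vHatCut :
    Tendsto (fun Λ : ℝ => eLpNorm (weighted (vHat - vHatCut Λ)) 2) atTop (𝓝 0) := by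
  refine tendsto_eLpNorm_zero_of_dominated two_ne_zero ENNReal.ofNat_ne_top
    (Eventually.of_forall fun Λ => (memLp_weighted_vHat_sub_vHatCut Λ).1) memLp_weighted_vHat
    (Eventually.of_forall fun Λ => Eventually.of_forall (norm_weighted_vHat_sub_vHatCut_le Λ))
    (Eventually.of_forall fun k => tendsto_const_nhds.congr' ?_)
  filter_upwards [eventually_gt_atTop ‖k‖] with Λ hΛ
  simp [weighted, vHatCut, Set.indicator_of_mem (show k ∈ {k : R3 | ‖k‖ < Λ} from hΛ)]

/-! ### The operator `H₀^{-1/2}` -/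

/-- The symbol of `H₀^{-1/2}`. -/
def invSqrtSymbol (P : R3) (n : ℕ) (K : Fin n → R3) : ℝ := (Real.sqrt (freeSymbol P n K))⁻¹

theorem sqrt_freeSymbol_pos (P : R3) (n : ℕ) (K : Fin n → R3) :
    0 < Real.sqrt (freeSymbol P n K) :=
  Real.sqrt_pos.2 (zero_lt_one.trans_le (one_le_freeSymbol P n K))

theorem invSqrtSymbol_pos (P : R3) (n : ℕ) (K : Fin n → R3) : 0 < invSqrtSymbol P n K :=
  inv_pos.2 (sqrt_freeSymbol_pos P n K)

theorem norm_invSqrtSymbol_le_one (P : R3) (n : ℕ) (K : Fin n → R3) :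
    ‖(invSqrtSymbol P n K : ℂ)‖ ≤ 1 := by
  rw [Complex.norm_real, Real.norm_of_nonneg (invSqrtSymbol_pos P n K).le]
  exact inv_le_one_of_one_le₀ (Real.one_le_sqrt.2 (one_le_freeSymbol P n K))

theorem measurable_invSqrtSymbol (P : R3) (n : ℕ) : Measurable (invSqrtSymbol P n) :=
  (continuous_freeSymbol P n).sqrt.measurable.inv

theorem invSqrtSymbol_mul_sqrt_freeSymbol (P : R3) (n : ℕ) (K : Fin n → R3) :
    (invSqrtSymbol P n K : ℂ) * Real.sqrt (freeSymbol P n K) = 1 := by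
  exact_mod_cast inv_mul_cancel₀ (sqrt_freeSymbol_pos P n K).ne'

theorem freeSymbol_mul_invSqrtSymbol_sq (P : R3) (n : ℕ) (K : Fin n → R3) :
    (freeSymbol P n K : ℂ) * invSqrtSymbol P n K ^ 2 = 1 := by
  have h := one_le_freeSymbol P n K
  have hreal : freeSymbol P n K * invSqrtSymbol P n K ^ 2 = 1 := by
    rw [invSqrtSymbol, inv_pow, Real.sq_sqrt (by linarith), mul_inv_cancel₀ (by linarith)]
  exact_mod_cast hreal

theorem exists_invSqrt (P : R3) : ∃ T : Fock →L[ℂ] Fock, ‖T‖ ≤ (1 : ℝ≥0) ∧ ∀ Ψ n,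
    sector (T Ψ) n =ᵐ[volume] fun K => (invSqrtSymbol P n K : ℂ) * sector Ψ n K :=
  exists_mulOperator
    (fun n => Complex.measurable_ofReal.comp (measurable_invSqrtSymbol P n))
    (norm_invSqrtSymbol_le_one P) (fun n K σ => by simp only [invSqrtSymbol, freeSymbol_perm])

/-- The bounded operator `H₀^{-1/2}`. -/
def invSqrt (P : R3) : Fock →L[ℂ] Fock := (exists_invSqrt P).choose

theorem norm_invSqrt_le_one (P : R3) : ‖invSqrt P‖ ≤ 1 := (exists_invSqrt P).choose_spec.1

theorem sector_invSqrt (P : R3) (Ψ : Fock) (n : ℕ) :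
    sector (invSqrt P Ψ) n =ᵐ[volume] fun K => (invSqrtSymbol P n K : ℂ) * sector Ψ n K :=
  (exists_invSqrt P).choose_spec.2 Ψ n

theorem isSelfAdjoint_invSqrt (P : R3) : IsSelfAdjoint (invSqrt P) :=
  isSelfAdjoint_of_sector_eq_ofReal_mul (sector_invSqrt P)

theorem mem_formDomain_iff (P : R3) (Ψ : Fock) : Ψ ∈ formDomain P ↔ ∃ x, invSqrt P x = Ψ := by
  constructor
  · rintro ⟨x, hx⟩
    refine ⟨x, Fock.ext_sector fun n => ?_⟩
    filter_upwards [sector_invSqrt P x n, hx n] with K h1 h2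
    rw [h1, h2, ← mul_assoc, invSqrtSymbol_mul_sqrt_freeSymbol, one_mul]
  · rintro ⟨x, rfl⟩
    refine ⟨x, fun n => ?_⟩
    filter_upwards [sector_invSqrt P x n] with K h
    rw [h, ← mul_assoc, mul_comm (Real.sqrt _ : ℂ), invSqrtSymbol_mul_sqrt_freeSymbol, one_mul]

theorem sector_invSqrt_invSqrt (P : R3) (Ψ : Fock) (n : ℕ) :
    sector (invSqrt P (invSqrt P Ψ)) n =ᵐ[volume]
      fun K => (invSqrtSymbol P n K : ℂ) ^ 2 * sector Ψ n K := by
  filter_upwards [sector_invSqrt P (invSqrt P Ψ) n, sector_invSqrt P Ψ n] with K h1 h2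
  rw [h1, h2]
  ring

theorem freeSymbol_mul_sector_invSqrt_invSqrt (P : R3) (x : Fock) (n : ℕ) :
    (fun K => (freeSymbol P n K : ℂ) * sector (invSqrt P (invSqrt P x)) n K) =ᵐ[volume]
      sector x n := by
  filter_upwards [sector_invSqrt_invSqrt P x n] with K h
  rw [h, ← mul_assoc, freeSymbol_mul_invSqrtSymbol_sq, one_mul]

theorem mem_freeDomain_iff (P : R3) (Ψ : Fock) :
    Ψ ∈ freeDomain P ↔ ∃ x, invSqrt P (invSqrt P x) = Ψ := by
  constructor
  · rintro ⟨x, hx⟩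
    refine ⟨x, Fock.ext_sector fun n => ?_⟩
    filter_upwards [sector_invSqrt_invSqrt P x n, hx n] with K h1 h2
    rw [h1, h2, ← mul_assoc, mul_comm (_ ^ 2), freeSymbol_mul_invSqrtSymbol_sq, one_mul]
  · rintro ⟨x, rfl⟩
    exact ⟨x, fun n => (freeSymbol_mul_sector_invSqrt_invSqrt P x n).symm⟩

/-! ### The coupling operators `H₀^{-1/2} a*(f) H₀^{-1/2}` -/

theorem succ_mul_one_add_norm_sq_le (P : R3) (n : ℕ) (K : Fin (n + 1) → R3) :
    (n + 1 : ℝ) * (1 + ‖K 0‖ ^ 2) ≤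
      2 * (freeSymbol P n (Fin.tail K) * freeSymbol P (n + 1) K) := by
  have htriangle : ‖K 0‖ ≤ ‖P - ∑ j, Fin.tail K j‖ + ‖P - ∑ j, K j‖ := by
    have h : K 0 = (P - ∑ j, Fin.tail K j) - (P - ∑ j, K j) := by
      rw [Fin.sum_univ_succ]
      simp only [Fin.tail]
      abel
    exact (congrArg norm h).trans_le (norm_sub_le _ _)
  unfold freeSymbol
  set a := ‖P - ∑ j, Fin.tail K j‖
  set b := ‖P - ∑ j, K j‖
  have hn : (0 : ℝ) ≤ n := n.cast_nonneg
  have hk : ‖K 0‖ ^ 2 ≤ 2 * (a ^ 2 + b ^ 2) := by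
    nlinarith [sq_nonneg (a - b), norm_nonneg (K 0)]
  have hmul : (n + 1 : ℝ) * ‖K 0‖ ^ 2 ≤ (n + 1) * (2 * (a ^ 2 + b ^ 2)) :=
    mul_le_mul_of_nonneg_left hk (by positivity)
  push_cast
  nlinarith [mul_nonneg (sq_nonneg a) (sq_nonneg b), sq_nonneg a, mul_nonneg hn hn]

theorem coupling_weight_le (P : R3) (n : ℕ) (K : Fin (n + 1) → R3) :
    Real.sqrt (n + 1) * (invSqrtSymbol P n (Fin.tail K) * invSqrtSymbol P (n + 1) K) ≤
      Real.sqrt 2 / Real.sqrt (1 + ‖K 0‖ ^ 2) := by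
  have h1 := one_le_freeSymbol P n (Fin.tail K)
  have h2 := one_le_freeSymbol P (n + 1) K
  rw [invSqrtSymbol, invSqrtSymbol, ← mul_inv, ← Real.sqrt_mul (by linarith), ← div_eq_mul_inv,
    ← Real.sqrt_div' _ (by positivity), ← Real.sqrt_div' _ (by positivity)]
  refine Real.sqrt_le_sqrt ?_
  rw [div_le_div_iff₀ (by positivity) (by positivity)]
  exact succ_mul_one_add_norm_sq_le P n K

/-- The kernel of `H₀^{-1/2} a*(f) H₀^{-1/2}` as a raising operator. -/
def couplingKernel (P : R3) (f : R3 → ℂ) (n : ℕ) (K : Fin (n + 1) → R3) : ℂ :=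
  (Real.sqrt (n + 1) : ℂ) * f (K 0) *
    ((invSqrtSymbol P n (Fin.tail K) : ℂ) * (invSqrtSymbol P (n + 1) K : ℂ))

theorem measurable_invSqrtSymbol_tail (P : R3) (n : ℕ) :
    Measurable fun K : Fin (n + 1) → R3 => (invSqrtSymbol P n (Fin.tail K) : ℂ) :=
  Complex.measurable_ofReal.comp ((measurable_invSqrtSymbol P n).comp
    (measurable_pi_lambda _ fun i => measurable_pi_apply i.succ))

theorem exists_isRaising_couplingKernel (P : R3) {f : R3 → ℂ} (hf : Measurable f)
    (hw : MemLp (weighted f) 2) :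
    ∃ U : Fock →L[ℂ] Fock, ‖U‖ ≤ (eLpNorm (weighted f) 2).toReal ∧
      IsRaising (couplingKernel P f) U := by
  refine exists_isRaising (fun n => ?_) hw fun n K => ?_
  · exact ((hf.comp (measurable_pi_apply 0)).const_mul _).mul
      ((measurable_invSqrtSymbol_tail P n).mul
        (Complex.measurable_ofReal.comp (measurable_invSqrtSymbol P (n + 1))))
  · have h1 := invSqrtSymbol_pos P n (Fin.tail K)
    have h2 := invSqrtSymbol_pos P (n + 1) K
    rw [couplingKernel, weighted, mul_right_comm, norm_mul, norm_mul _ (f (K 0)),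
      ← Complex.ofReal_mul, ← Complex.ofReal_mul, Complex.norm_real, Complex.norm_real,
      Real.norm_of_nonneg (by positivity), Real.norm_of_nonneg (by positivity)]
    exact mul_le_mul_of_nonneg_right (coupling_weight_le P n K) (norm_nonneg _)

theorem norm_sub_le_of_isRaising_couplingKernel {P : R3} {f f' : R3 → ℂ} (hf : Measurable f)
    (hf' : Measurable f') (hw : MemLp (weighted (f - f')) 2) {U U' : Fock →L[ℂ] Fock}
    (hU : IsRaising (couplingKernel P f) U) (hU' : IsRaising (couplingKernel P f') U') :
    ‖U - U'‖ ≤ (eLpNorm (weighted (f - f')) 2).toReal := by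
  obtain ⟨V, hV, hVf⟩ := exists_isRaising_couplingKernel P (hf.sub hf') hw
  have e : couplingKernel P (f - f') = couplingKernel P f - couplingKernel P f' := by
    funext n K
    simp only [couplingKernel, Pi.sub_apply]
    ring
  rw [e] at hVf
  rwa [(hU.sub hU').ext hVf]

/-! ### The form of `H(P) + 1` as a form perturbation -/

section FieldPerturbation

variable {H : Type*} [NormedAddCommGroup H] [InnerProductSpace ℂ H] [CompleteSpace H]

/-- The bounded form perturbation `√α (U + U*)`; for `U = H₀^{-1/2} a*(f) H₀^{-1/2}` it is
`H₀^{-1/2} √α (a(f) + a*(f)) H₀^{-1/2}`. -/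
def fieldPerturbation (α : ℝ) (U : H →L[ℂ] H) : H →L[ℂ] H :=
  (Real.sqrt α : ℂ) • (U + star U)

theorem isSelfAdjoint_fieldPerturbation (α : ℝ) (U : H →L[ℂ] H) :
    IsSelfAdjoint (fieldPerturbation α U) :=
  IsSelfAdjoint.smul (Complex.conj_ofReal _) (IsSelfAdjoint.add_star_self U)

theorem norm_fieldPerturbation_sub_le (α : ℝ) (U V : H →L[ℂ] H) :
    ‖fieldPerturbation α U - fieldPerturbation α V‖ ≤ 2 * Real.sqrt α * ‖U - V‖ :=
  calc ‖fieldPerturbation α U - fieldPerturbation α V‖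
      = Real.sqrt α * ‖(U - V) + star (U - V)‖ := by
        rw [fieldPerturbation, fieldPerturbation, ← smul_sub, add_sub_add_comm, ← star_sub,
          norm_smul, Complex.norm_real, Real.norm_of_nonneg (Real.sqrt_nonneg _)]
    _ ≤ Real.sqrt α * (‖U - V‖ + ‖star (U - V)‖) := by gcongr; exact norm_add_le _ _
    _ = 2 * Real.sqrt α * ‖U - V‖ := by rw [norm_star]; ring

theorem inner_fieldPerturbation (α : ℝ) (U : H →L[ℂ] H) (x y : H) :
    (inner ℂ x (fieldPerturbation α U y) : ℂ) =
      (Real.sqrt α : ℂ) * (conj (inner ℂ y (U x)) + inner ℂ x (U y)) := by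
  rw [fieldPerturbation, smul_apply, add_apply,
    ContinuousLinearMap.star_eq_adjoint, inner_smul_right, inner_add_right, inner_conj_symm,
    ContinuousLinearMap.adjoint_inner_right, add_comm]

end FieldPerturbation

theorem freeKernel_invSqrt (P : R3) (x y : Fock) (n : ℕ) :
    freeKernel P (sector (invSqrt P x) n) (sector (invSqrt P y) n) =ᵐ[volume]
      fun K => conj (sector x n K) * sector y n K := by
  filter_upwards [sector_invSqrt P x n, sector_invSqrt P y n] with K h1 h2
  rw [freeKernel, h1, h2, map_mul, Complex.conj_ofReal]
  linear_combination
    (conj (sector x n K) * sector y n K) * freeSymbol_mul_invSqrtSymbol_sq P n K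

theorem sqrt_succ_ne_zero (n : ℕ) : (Real.sqrt (n + 1) : ℂ) ≠ 0 := by
  exact_mod_cast (Real.sqrt_pos.2 (by positivity : (0 : ℝ) < n + 1)).ne'

theorem annihKernel_invSqrt (P : R3) (f : R3 → ℂ) (x y : Fock) (n : ℕ) :
    annihKernel f (sector (invSqrt P x) n) (sector (invSqrt P y) (n + 1)) =ᵐ[volume]
      fun K => (Real.sqrt (n + 1) : ℂ)⁻¹ *
        conj (raisingIntegrand (couplingKernel P f) y x n K) := by
  filter_upwards [ae_tail (sector_invSqrt P x n), sector_invSqrt P y (n + 1)] with K h1 h2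
  have hn := sqrt_succ_ne_zero n
  rw [annihKernel, h1, h2, raisingIntegrand, couplingKernel]
  simp only [map_mul, Complex.conj_ofReal, Complex.conj_conj]
  field_simp

theorem integrable_annihKernel_invSqrt {P : R3} {f : R3 → ℂ} {U : Fock →L[ℂ] Fock}
    (hU : IsRaising (couplingKernel P f) U) (x y : Fock) (n : ℕ) :
    Integrable (annihKernel f (sector (invSqrt P x) n) (sector (invSqrt P y) (n + 1))) :=
  (((Complex.conjCLE : ℂ ≃L[ℝ] ℂ).integrable_comp_iff.2 ((hU y x).1 n)).const_mul _).congr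
    (annihKernel_invSqrt P f x y n).symm

theorem annihForm_invSqrt (P : R3) (f : R3 → ℂ) (x y : Fock) (n : ℕ) :
    annihForm f (sector (invSqrt P x) n) (sector (invSqrt P y) (n + 1)) =
      conj (∫ K, raisingIntegrand (couplingKernel P f) y x n K) := by
  rw [annihForm, integral_congr_ae (annihKernel_invSqrt P f x y n), integral_const_mul,
    ← mul_assoc, mul_inv_cancel₀ (sqrt_succ_ne_zero n), one_mul]
  exact integral_conj

theorem formTermConverges_invSqrt {P : R3} {U : Fock →L[ℂ] Fock}
    (hU : IsRaising (couplingKernel P vHat) U) (x y : Fock) (n : ℕ) :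
    FormTermConverges P (invSqrt P x) (invSqrt P y) n := by
  refine ⟨Integrable.congr ?_ (freeKernel_invSqrt P x y n).symm,
    integrable_annihKernel_invSqrt hU x y n, integrable_annihKernel_invSqrt hU y x n⟩
  exact ((memLp_sector y n).integrable_mul (p := 2) (q := 2) (memLp_sector x n).star).congr
    (Eventually.of_forall fun K => mul_comm _ _)

theorem hasForm_invSqrt (α : ℝ) {P : R3} {U : Fock →L[ℂ] Fock}
    (hU : IsRaising (couplingKernel P vHat) U) (x y : Fock) :
    HasForm α P (invSqrt P x) (invSqrt P y) (inner ℂ x (y + fieldPerturbation α U y)) := by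
  refine ⟨formTermConverges_invSqrt hU x y, ?_⟩
  have hsum := (hasSum_inner_sector x y).add
    (((Complex.hasSum_conj'.2 (hU y x).2).add (hU x y).2).mul_left (Real.sqrt α : ℂ))
  rw [inner_add_right, inner_fieldPerturbation]
  refine hsum.congr_fun fun n => ?_
  rw [formTerm, integral_congr_ae (freeKernel_invSqrt P x y n), annihForm_invSqrt,
    annihForm_invSqrt, Complex.conj_conj]

theorem isFormSum_fiberHamiltonian (α : ℝ) {P : R3} {U : Fock →L[ℂ] Fock}
    (hU : IsRaising (couplingKernel P vHat) U) :
    IsFormSum (invSqrt P) (fieldPerturbation α U) (fiberHamiltonian α P) := by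
  have hT := ContinuousLinearMap.isSelfAdjoint_iff_isSymmetric.1 (isSelfAdjoint_invSqrt P)
  intro Ψ η
  rw [fiberHamiltonian_graph]
  constructor
  · rintro ⟨hΨ, hform⟩
    obtain ⟨y, rfl⟩ := (mem_formDomain_iff P Ψ).1 hΨ
    refine ⟨y, rfl, ext_inner_left ℂ fun x => ?_⟩
    have hx := hform _ ((mem_formDomain_iff P _).2 ⟨x, rfl⟩)
    exact ((hasForm_invSqrt α hU x y).2.unique hx.2).trans (hT x _)
  · rintro ⟨y, rfl, hy⟩
    refine ⟨(mem_formDomain_iff P _).2 ⟨y, rfl⟩, fun Φ hΦ => ?_⟩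
    obtain ⟨x, rfl⟩ := (mem_formDomain_iff P Φ).1 hΦ
    have h := hasForm_invSqrt α hU x y
    rw [hy] at h
    exact (hT x _).symm ▸ h

/-! ### Creation and annihilation with a square-integrable form factor -/

/-- Invariance under permutations of the momenta, almost everywhere: the condition cutting out
`symL2`, for functions rather than classes. -/
def IsSymm {n : ℕ} (φ : (Fin n → R3) → ℂ) : Prop :=
  ∀ σ : Equiv.Perm (Fin n), (fun K => φ (K ∘ σ)) =ᵐ[volume] φ

theorem isSymm_sector (Ψ : Fock) (n : ℕ) : IsSymm (sector Ψ n) := (Ψ n).2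

/-- The tensor product `f ⊗ φ` of a one-phonon and an `n`-phonon function, with the momentum of
the new phonon in front. -/
def tensorHead (f : R3 → ℂ) {n : ℕ} (φ : (Fin n → R3) → ℂ) (K : Fin (n + 1) → R3) : ℂ :=
  f (K 0) * φ (Fin.tail K)

section Creation

variable {n : ℕ} {f : R3 → ℂ} {φ : (Fin n → R3) → ℂ}

theorem memLp_tensorHead (hf : MemLp f 2) (hφ : MemLp φ 2) : MemLp (tensorHead f φ) 2 :=
  memLp_head_smul_tail two_ne_zero ENNReal.ofNat_ne_top hf hφ

theorem IsSymm.tensorHead_comp_perm (hφ : IsSymm φ) (f : R3 → ℂ) {ρ : Equiv.Perm (Fin (n + 1))}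
    (hρ : ρ 0 = 0) : (fun K => tensorHead f φ (K ∘ ρ)) =ᵐ[volume] tensorHead f φ := by
  obtain ⟨⟨p, τ⟩, rfl⟩ := Equiv.Perm.decomposeFin.symm.surjective ρ
  obtain rfl : p = 0 := by rwa [Equiv.Perm.decomposeFin_symm_apply_zero] at hρ
  filter_upwards [ae_tail (hφ τ)] with K hK
  have htail : Fin.tail (K ∘ Equiv.Perm.decomposeFin.symm (0, τ)) = Fin.tail K ∘ τ := by
    funext i
    simp [Fin.tail]
  rw [tensorHead, htail, hK, Function.comp_apply, hρ, tensorHead]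

theorem IsSymm.tensorHead_comp_perm_congr (hφ : IsSymm φ) (f : R3 → ℂ)
    {ρ ρ' : Equiv.Perm (Fin (n + 1))} (h : ρ 0 = ρ' 0) :
    (fun K => tensorHead f φ (K ∘ ρ)) =ᵐ[volume] fun K => tensorHead f φ (K ∘ ρ') := by
  have hfix : (ρ'⁻¹ * ρ) 0 = 0 := by simp [h]
  have hK := (measurePreserving_perm (n + 1) ρ').quasiMeasurePreserving.ae_eq_comp
    (hφ.tensorHead_comp_perm f hfix)
  refine EventuallyEq.trans (Eventually.of_forall fun K => ?_) hK
  have hcomp : (K ∘ ρ') ∘ ⇑(ρ'⁻¹ * ρ) = K ∘ ρ := by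
    funext i
    simp
  exact congrArg (tensorHead f φ) hcomp.symm

theorem creat_eq_sum_tensorHead (f : R3 → ℂ) (φ : (Fin n → R3) → ℂ) (K : Fin (n + 1) → R3) :
    creat f n φ K = (Real.sqrt (n + 1) : ℂ)⁻¹ *
      ∑ j : Fin (n + 1), tensorHead f φ (K ∘ j.cycleRange.symm) := by
  rw [creat]
  congr! 2 with j
  have htail : Fin.tail (K ∘ j.cycleRange.symm) = j.removeNth K := by
    funext i
    simp [Fin.tail, Fin.removeNth]
  rw [tensorHead, htail, Function.comp_apply, Fin.cycleRange_symm_zero]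

theorem memLp_creat (hf : MemLp f 2) (hφ : MemLp φ 2) : MemLp (creat f n φ) 2 := by
  have h := (memLp_finsetSum Finset.univ fun (j : Fin (n + 1)) _ =>
    (memLp_tensorHead hf hφ).comp_measurePreserving
      (measurePreserving_perm (n + 1) j.cycleRange.symm)).const_mul (Real.sqrt (n + 1) : ℂ)⁻¹
  exact h.ae_eq (Eventually.of_forall fun K => (creat_eq_sum_tensorHead f φ K).symm)

theorem isSymm_creat (hφ : IsSymm φ) : IsSymm (creat f n φ) := by
  intro σ
  have hcoset : ∀ j : Fin (n + 1), ∀ᵐ K : Fin (n + 1) → R3,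
      tensorHead f φ (K ∘ ⇑(σ * j.cycleRange.symm)) =
        tensorHead f φ (K ∘ (σ j).cycleRange.symm) := fun j =>
    hφ.tensorHead_comp_perm_congr f (by simp)
  filter_upwards [ae_all_iff.2 hcoset] with K hK
  simp only [creat_eq_sum_tensorHead]
  rw [← Equiv.sum_comp σ fun j => tensorHead f φ (K ∘ j.cycleRange.symm)]
  simp only [← hK]
  rfl

theorem IsSymm.integral_conj_mul_comp_perm {χ g : (Fin n → R3) → ℂ} (hχ : IsSymm χ)
    (hχm : AEStronglyMeasurable χ) (hg : AEStronglyMeasurable g) (σ : Equiv.Perm (Fin n)) :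
    ∫ K, conj (χ K) * g (K ∘ σ) = ∫ K, conj (χ K) * g K := by
  have h : AEStronglyMeasurable fun K => conj (χ K) * g K := hχm.star.mul hg
  rw [← integral_comp_of_measurePreserving (measurePreserving_perm n σ) h]
  refine integral_congr_ae ?_
  filter_upwards [hχ σ] with K hK
  rw [hK]

theorem integral_conj_mul_creat (hf : MemLp f 2) (hφ : MemLp φ 2)
    {χ : (Fin (n + 1) → R3) → ℂ} (hχ : MemLp χ 2) (hχs : IsSymm χ) :
    ∫ K, conj (χ K) * creat f n φ K =
      (Real.sqrt (n + 1) : ℂ) * ∫ K, conj (χ K) * tensorHead f φ K := by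
  have ht := memLp_tensorHead hf hφ
  have hi : ∀ σ : Equiv.Perm (Fin (n + 1)),
      Integrable fun K => conj (χ K) * tensorHead f φ (K ∘ σ) := fun σ =>
    hχ.star.integrable_mul (ht.comp_measurePreserving (measurePreserving_perm (n + 1) σ))
  have hsq : (Real.sqrt (n + 1) : ℂ)⁻¹ * (n + 1) = Real.sqrt (n + 1) := by
    rw [inv_mul_eq_iff_eq_mul₀ (sqrt_succ_ne_zero n), ← Complex.ofReal_mul,
      Real.mul_self_sqrt (by positivity)]
    push_cast
    rfl
  calc ∫ K, conj (χ K) * creat f n φ K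
      = ∫ K, (Real.sqrt (n + 1) : ℂ)⁻¹ *
          ∑ j : Fin (n + 1), conj (χ K) * tensorHead f φ (K ∘ j.cycleRange.symm) := by
        simp only [creat_eq_sum_tensorHead, ← Finset.mul_sum, mul_left_comm]
    _ = (Real.sqrt (n + 1) : ℂ)⁻¹ *
          ∑ j : Fin (n + 1), ∫ K, conj (χ K) * tensorHead f φ (K ∘ j.cycleRange.symm) := by
        rw [integral_const_mul, integral_finsetSum _ fun j _ => hi _]
    _ = (Real.sqrt (n + 1) : ℂ)⁻¹ * ((n + 1) * ∫ K, conj (χ K) * tensorHead f φ K) := by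
        simp only [hχs.integral_conj_mul_comp_perm hχ.1 ht.1, Finset.sum_const, Finset.card_univ,
          Fintype.card_fin, nsmul_eq_mul, Nat.cast_add, Nat.cast_one]
    _ = _ := by rw [← mul_assoc, hsq]

end Creation

section Annihilation

variable {n : ℕ} {f : R3 → ℂ} {ψ : (Fin (n + 1) → R3) → ℂ}

theorem annihConverges_of_memLp (hf : MemLp f 2) (hψ : MemLp ψ 2) : AnnihConverges f n ψ := by
  filter_upwards [ae_memLp_slice two_ne_zero ENNReal.ofNat_ne_top
    (hψ.comp_measurePreserving (measurePreserving_cons n))] with K hK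
  exact hf.star.integrable_mul hK

theorem memLp_annih (hf : MemLp f 2) (hψ : MemLp ψ 2) : MemLp (annih f n ψ) 2 :=
  (memLp_integral_smul_slice two_ne_zero ENNReal.ofNat_ne_top hf.star
    (hψ.comp_measurePreserving (measurePreserving_cons n))).const_mul _

theorem isSymm_annih (hψ : IsSymm ψ) : IsSymm (annih f n ψ) := by
  intro σ
  filter_upwards [ae_cons (hψ (Equiv.Perm.decomposeFin.symm (0, σ)))] with K hK
  rw [annih, annih]
  congr 1
  refine integral_congr_ae ?_
  filter_upwards [hK] with k hk
  have hcons : (Fin.cons k K : Fin (n + 1) → R3) ∘ Equiv.Perm.decomposeFin.symm (0, σ)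
      = Fin.cons k (K ∘ σ) := by
    funext i
    refine Fin.cases ?_ (fun i => ?_) i <;> simp
  rw [← hk, hcons]

theorem integral_conj_mul_annih (hf : MemLp f 2) (hψ : MemLp ψ 2) {χ : (Fin n → R3) → ℂ}
    (hχ : MemLp χ 2) : ∫ K, conj (χ K) * annih f n ψ K =
      (Real.sqrt (n + 1) : ℂ) * ∫ K, conj (tensorHead f χ K) * ψ K := by
  have hi : Integrable fun K => conj (tensorHead f χ K) * ψ K :=
    (memLp_tensorHead hf hχ).star.integrable_mul hψ
  have hi' : Integrable fun y : R3 × (Fin n → R3) =>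
      conj (tensorHead f χ (Fin.cons y.1 y.2)) * ψ (Fin.cons y.1 y.2) :=
    (measurePreserving_cons n).integrable_comp_of_integrable hi
  rw [← integral_comp_of_measurePreserving (measurePreserving_cons n) hi.1,
    integral_prod_symm _ hi', ← integral_const_mul]
  refine integral_congr_ae (Eventually.of_forall fun K => ?_)
  simp only [annih, ← integral_const_mul]
  refine integral_congr_ae (Eventually.of_forall fun k => ?_)
  simp only [tensorHead, Fin.cons_zero, Fin.tail_cons, map_mul]
  ring

end Annihilation

section Components

theorem ae_eq_of_forall_inner_eq {n : ℕ} {a : symL2 n} {g : (Fin n → R3) → ℂ} (hg : MemLp g 2)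
    (hs : IsSymm g) (h : ∀ χ : symL2 n, inner ℂ χ a = ∫ K, conj ((χ : L2n n) K) * g K) :
    (a : L2n n) =ᵐ[volume] g := by
  have hc := hg.coeFn_toLp
  have hmem : hg.toLp ∈ symL2 n := fun σ => (hc.comp_tendsto
    (measurePreserving_perm n σ).quasiMeasurePreserving.tendsto_ae).trans ((hs σ).trans hc.symm)
  have ha : a = ⟨hg.toLp, hmem⟩ := by
    refine ext_inner_left ℂ fun χ => ?_
    rw [h, Submodule.coe_inner, L2n_inner_eq]
    refine integral_congr_ae ?_
    filter_upwards [hc] with K hK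
    rw [hK]
  rw [ha]
  exact hc

theorem sector_single_same {n : ℕ} (χ : symL2 n) :
    sector (lp.single 2 n χ : Fock) n = (χ : L2n n) := by
  simp only [sector, lp.coeFn_single, Pi.single_eq_same]

theorem sector_single_of_ne {n i : ℕ} (hi : i ≠ n) (χ : symL2 n) :
    sector (lp.single 2 n χ : Fock) i =ᵐ[volume] 0 := by
  simp only [sector, lp.coeFn_single, Pi.single_eq_of_ne hi]
  exact Lp.coeFn_zero _ _ _

variable {m : ∀ n, (Fin (n + 1) → R3) → ℂ} {U : Fock →L[ℂ] Fock}

theorem integral_raisingIntegrand_single_left {n i : ℕ} (hi : i + 1 ≠ n) (χ : symL2 n) (Ψ : Fock) :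
    ∫ K, raisingIntegrand m (lp.single 2 n χ) Ψ i K = 0 := by
  refine integral_eq_zero_of_ae ?_
  filter_upwards [sector_single_of_ne hi χ] with K hK
  rw [raisingIntegrand, hK, Pi.zero_apply, map_zero, zero_mul]

theorem integral_raisingIntegrand_single_right {n i : ℕ} (hi : i ≠ n) (Φ : Fock) (χ : symL2 n) :
    ∫ K, raisingIntegrand m Φ (lp.single 2 n χ) i K = 0 := by
  refine integral_eq_zero_of_ae ?_
  filter_upwards [ae_tail (sector_single_of_ne hi χ)] with K hK
  rw [raisingIntegrand, hK, Pi.zero_apply, mul_zero, mul_zero]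
  rfl

theorem IsRaising.inner_apply_succ (hU : IsRaising m U) (Ψ : Fock) (n : ℕ) (χ : symL2 (n + 1)) :
    inner ℂ χ (U Ψ (n + 1)) =
      ∫ K, conj ((χ : L2n (n + 1)) K) * (m n K * sector Ψ n (Fin.tail K)) := by
  have h := (hU (lp.single 2 (n + 1) χ) Ψ).2
  rw [lp.inner_single_left] at h
  rw [h.unique (hasSum_single n fun i hi =>
    integral_raisingIntegrand_single_left ((add_left_injective 1).ne hi) χ Ψ)]
  simp only [raisingIntegrand, sector_single_same]

theorem IsRaising.apply_zero (hU : IsRaising m U) (Ψ : Fock) : U Ψ 0 = 0 := by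
  refine ext_inner_left ℂ fun χ => ?_
  have h := (hU (lp.single 2 0 χ) Ψ).2
  simp only [lp.inner_single_left,
    integral_raisingIntegrand_single_left (Nat.succ_ne_zero _) χ Ψ] at h
  rw [inner_zero_right, h.unique hasSum_zero]

theorem IsRaising.inner_adjoint_apply (hU : IsRaising m U) (Ψ : Fock) (n : ℕ) (χ : symL2 n) :
    inner ℂ χ (ContinuousLinearMap.adjoint U Ψ n) =
      ∫ K, conj (m n K * (χ : L2n n) (Fin.tail K)) * sector Ψ (n + 1) K := by
  have h := (hU Ψ (lp.single 2 n χ)).2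
  refine (lp.inner_single_left (𝕜 := ℂ) n χ (ContinuousLinearMap.adjoint U Ψ)).symm.trans ?_
  rw [ContinuousLinearMap.adjoint_inner_right, ← inner_conj_symm, h.unique
    (hasSum_single n fun i hi => integral_raisingIntegrand_single_right hi Ψ χ), ← integral_conj]
  simp only [raisingIntegrand, sector_single_same, map_mul, Complex.conj_conj, mul_comm]

end Components

/-- The kernel of `a*(f) H₀^{-1/2}`. -/
def creationKernel (P : R3) (f : R3 → ℂ) (n : ℕ) (K : Fin (n + 1) → R3) : ℂ :=
  (Real.sqrt (n + 1) : ℂ) * f (K 0) * (invSqrtSymbol P n (Fin.tail K) : ℂ)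

/-- The kernel of `H₀^{-1/2} a*(f)`, whose adjoint is `a(f) H₀^{-1/2}`. -/
def dualCreationKernel (P : R3) (f : R3 → ℂ) (n : ℕ) (K : Fin (n + 1) → R3) : ℂ :=
  (Real.sqrt (n + 1) : ℂ) * f (K 0) * (invSqrtSymbol P (n + 1) K : ℂ)

theorem sqrt_mul_invSqrtSymbol_le_one (P : R3) {n i : ℕ} (hi : n ≤ i) (K : Fin i → R3) :
    Real.sqrt (n + 1) * invSqrtSymbol P i K ≤ 1 := by
  rw [invSqrtSymbol, ← div_eq_mul_inv, div_le_one (sqrt_freeSymbol_pos P i K)]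
  refine Real.sqrt_le_sqrt ?_
  have hi' : (n : ℝ) ≤ i := by exact_mod_cast hi
  rw [freeSymbol]
  linarith [sq_nonneg ‖P - ∑ j, K j‖]

theorem norm_sqrt_mul_mul_invSqrtSymbol_le (P : R3) {n i : ℕ} (hi : n ≤ i) (K : Fin i → R3)
    (c : ℂ) : ‖(Real.sqrt (n + 1) : ℂ) * c * (invSqrtSymbol P i K : ℂ)‖ ≤ ‖c‖ := by
  rw [mul_right_comm, norm_mul, ← Complex.ofReal_mul, Complex.norm_real, Real.norm_of_nonneg
    (mul_nonneg (Real.sqrt_nonneg _) (invSqrtSymbol_pos P i K).le)]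
  exact mul_le_of_le_one_left (norm_nonneg _) (sqrt_mul_invSqrtSymbol_le_one P hi K)

section FormFactor

variable {P : R3} {f : R3 → ℂ}

theorem exists_isRaising_creationKernel (P : R3) (hf : Measurable f) (hf2 : MemLp f 2) :
    ∃ D : Fock →L[ℂ] Fock, ‖D‖ ≤ (eLpNorm f 2).toReal ∧ IsRaising (creationKernel P f) D :=
  exists_isRaising (fun n => ((hf.comp (measurable_pi_apply 0)).const_mul _).mul
      (measurable_invSqrtSymbol_tail P n)) hf2
    fun _ _ => norm_sqrt_mul_mul_invSqrtSymbol_le P le_rfl _ _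

theorem exists_isRaising_dualCreationKernel (P : R3) (hf : Measurable f) (hf2 : MemLp f 2) :
    ∃ A : Fock →L[ℂ] Fock, ‖A‖ ≤ (eLpNorm f 2).toReal ∧ IsRaising (dualCreationKernel P f) A :=
  exists_isRaising (fun n => ((hf.comp (measurable_pi_apply 0)).const_mul _).mul
      (Complex.measurable_ofReal.comp (measurable_invSqrtSymbol P (n + 1)))) hf2
    fun n _ => norm_sqrt_mul_mul_invSqrtSymbol_le P n.le_succ _ _

theorem IsRaising.invSqrt_mul {D : Fock →L[ℂ] Fock} (hD : IsRaising (creationKernel P f) D) :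
    IsRaising (couplingKernel P f) (invSqrt P * D) := by
  intro Φ Ψ
  have e : ∀ n, raisingIntegrand (creationKernel P f) (invSqrt P Φ) Ψ n =ᵐ[volume]
      raisingIntegrand (couplingKernel P f) Φ Ψ n := fun n => by
    filter_upwards [sector_invSqrt P Φ (n + 1)] with K hK
    simp only [raisingIntegrand, hK, creationKernel, couplingKernel, map_mul, Complex.conj_ofReal]
    ring
  have hT := ContinuousLinearMap.isSelfAdjoint_iff_isSymmetric.1 (isSelfAdjoint_invSqrt P) Φ (D Ψ)
  obtain ⟨hi, hsum⟩ := hD (invSqrt P Φ) Ψ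
  refine ⟨fun n => (hi n).congr (e n), ?_⟩
  simp only [fun n => integral_congr_ae (e n)] at hsum
  exact hT ▸ hsum

theorem IsRaising.mul_invSqrt {A : Fock →L[ℂ] Fock} (hA : IsRaising (dualCreationKernel P f) A) :
    IsRaising (couplingKernel P f) (A * invSqrt P) := by
  intro Φ Ψ
  have e : ∀ n, raisingIntegrand (dualCreationKernel P f) Φ (invSqrt P Ψ) n =ᵐ[volume]
      raisingIntegrand (couplingKernel P f) Φ Ψ n := fun n => by
    filter_upwards [ae_tail (sector_invSqrt P Ψ n)] with K hK
    simp only [raisingIntegrand, hK, dualCreationKernel, couplingKernel]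
    ring
  obtain ⟨hi, hsum⟩ := hA Φ (invSqrt P Ψ)
  refine ⟨fun n => (hi n).congr (e n), ?_⟩
  simp only [fun n => integral_congr_ae (e n)] at hsum
  exact hsum

theorem sector_creation (hf : MemLp f 2) {D : Fock →L[ℂ] Fock}
    (hD : IsRaising (creationKernel P f) D) (Ψ : Fock) :
    ∀ n, sector (D Ψ) n =ᵐ[volume] creatSector f (invSqrt P Ψ) n
  | 0 => by
    rw [sector, hD.apply_zero]
    exact Lp.coeFn_zero _ _ _
  | n + 1 => by
    have hφ := memLp_sector (invSqrt P Ψ) n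
    refine ae_eq_of_forall_inner_eq (memLp_creat hf hφ)
      (isSymm_creat (isSymm_sector (invSqrt P Ψ) n)) fun χ => ?_
    rw [hD.inner_apply_succ, creatSector, integral_conj_mul_creat hf hφ (Lp.memLp _) χ.2,
      ← integral_const_mul]
    refine integral_congr_ae ?_
    filter_upwards [ae_tail (sector_invSqrt P Ψ n)] with K hK
    rw [tensorHead, hK, creationKernel]
    ring

theorem sector_annihilation (hf : MemLp f 2) {A : Fock →L[ℂ] Fock}
    (hA : IsRaising (dualCreationKernel P f) A) (Ψ : Fock) (n : ℕ) :
    sector (ContinuousLinearMap.adjoint A Ψ) n =ᵐ[volume]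
      annih f n (sector (invSqrt P Ψ) (n + 1)) := by
  have hψ := memLp_sector (invSqrt P Ψ) (n + 1)
  refine ae_eq_of_forall_inner_eq (memLp_annih hf hψ)
    (isSymm_annih (isSymm_sector (invSqrt P Ψ) (n + 1))) fun χ => ?_
  rw [hA.inner_adjoint_apply, integral_conj_mul_annih hf hψ (Lp.memLp _), ← integral_const_mul]
  refine integral_congr_ae ?_
  filter_upwards [sector_invSqrt P Ψ (n + 1)] with K hK
  simp only [tensorHead, hK, dualCreationKernel, map_mul, Complex.conj_ofReal]
  ring

end FormFactor

/-! ### The Hamiltonian with cutoff and the removal of the cutoff -/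

section Factorization

variable {H : Type*} [NormedAddCommGroup H] [InnerProductSpace ℂ H] [CompleteSpace H]

theorem fieldPerturbation_eq_mul {T D A U : H →L[ℂ] H} (α : ℝ) (hT : IsSelfAdjoint T)
    (hD : U = T * D) (hA : U = A * T) :
    fieldPerturbation α U = T * ((Real.sqrt α : ℂ) • (D + star A)) := by
  have hstar : star U = T * star A := by rw [hA, star_mul, hT.star_eq]
  rw [fieldPerturbation, hstar, mul_smul_comm, mul_add, ← hD]

theorem norm_sqrt_smul_add_star_le {D A : H →L[ℂ] H} {M : ℝ} (α : ℝ) (hD : ‖D‖ ≤ M)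
    (hA : ‖A‖ ≤ M) : ‖(Real.sqrt α : ℂ) • (D + star A)‖ ≤ 2 * Real.sqrt α * M :=
  calc ‖(Real.sqrt α : ℂ) • (D + star A)‖
      = Real.sqrt α * ‖D + star A‖ := by
        rw [norm_smul, Complex.norm_real, Real.norm_of_nonneg (Real.sqrt_nonneg _)]
    _ ≤ Real.sqrt α * (M + M) := by
        gcongr
        exact norm_add_le_of_le hD ((norm_star A).trans_le hA)
    _ = 2 * Real.sqrt α * M := by ring

end Factorization

section CutoffGraph

variable {P : R3} {f : R3 → ℂ} {D A : Fock →L[ℂ] Fock}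

theorem sector_sqrt_smul_creation_add_annihilation (α : ℝ) (hf : MemLp f 2)
    (hD : IsRaising (creationKernel P f) D) (hA : IsRaising (dualCreationKernel P f) A)
    (y : Fock) (n : ℕ) :
    sector (((Real.sqrt α : ℂ) • (D + star A)) y) n =ᵐ[volume] fun K => (Real.sqrt α : ℂ) *
      (annih f n (sector (invSqrt P y) (n + 1)) K + creatSector f (invSqrt P y) n K) := by
  rw [ContinuousLinearMap.star_eq_adjoint, smul_apply, add_apply]
  filter_upwards [sector_smul (Real.sqrt α : ℂ) (D y + ContinuousLinearMap.adjoint A y) n,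
    sector_add (D y) (ContinuousLinearMap.adjoint A y) n, sector_creation hf hD y n,
    sector_annihilation hf hA y n] with K hsmul hadd hcreat hannih
  rw [hsmul, Pi.smul_apply, hadd, Pi.add_apply, hcreat, hannih, smul_eq_mul,
    add_comm (annih _ _ _ _)]

theorem mem_cutoffGraph_iff (α : ℝ) (hf : MemLp f 2) (hD : IsRaising (creationKernel P f) D)
    (hA : IsRaising (dualCreationKernel P f) A) (Ψ η : Fock) :
    (Ψ, η) ∈ cutoffGraph α f P ↔ ∃ x, invSqrt P (invSqrt P x) = Ψ ∧
      η + Ψ = x + ((Real.sqrt α : ℂ) • (D + star A)) (invSqrt P x) := by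
  have hC := sector_sqrt_smul_creation_add_annihilation α hf hD hA
  set C := (Real.sqrt α : ℂ) • (D + star A)
  constructor
  · rintro ⟨hΨ, -, hη⟩
    obtain ⟨x, rfl⟩ := (mem_freeDomain_iff P Ψ).1 hΨ
    refine ⟨x, rfl, Fock.ext_sector fun n => ?_⟩
    filter_upwards [hη n, hC (invSqrt P x) n, freeSymbol_mul_sector_invSqrt_invSqrt P x n,
      sector_add η (invSqrt P (invSqrt P x)) n, sector_add x (C (invSqrt P x)) n]
      with K hηK hCK hfree hleft hright
    rw [hleft, hright, Pi.add_apply, Pi.add_apply, hCK, ← hfree, hηK]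
    push_cast
    ring
  · rintro ⟨x, rfl, hx⟩
    refine ⟨(mem_freeDomain_iff P _).2 ⟨x, rfl⟩,
      fun n => annihConverges_of_memLp hf (memLp_sector _ _), fun n => ?_⟩
    have hright := sector_add x (C (invSqrt P x)) n
    rw [← hx] at hright
    filter_upwards [hC (invSqrt P x) n, freeSymbol_mul_sector_invSqrt_invSqrt P x n,
      sector_add η (invSqrt P (invSqrt P x)) n, hright] with K hCK hfree hleft hrightK
    rw [hleft, Pi.add_apply, Pi.add_apply, hCK, ← hfree] at hrightK
    push_cast
    linear_combination hrightK

/-- For a square-integrable form factor the creation and annihilation operators are bounded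
relative to `H₀^{1/2}`, so that the form perturbation factors through `H₀^{-1/2}`. -/
theorem exists_fieldPerturbation_factor (α : ℝ) (P : R3) (hf : Measurable f) (hf2 : MemLp f 2) :
    ∃ C : Fock →L[ℂ] Fock, ‖C‖ ≤ 2 * Real.sqrt α * (eLpNorm f 2).toReal ∧
      (∀ U, IsRaising (couplingKernel P f) U → fieldPerturbation α U = invSqrt P * C) ∧
      ∀ Ψ η, (Ψ, η) ∈ cutoffGraph α f P ↔
        ∃ x, invSqrt P (invSqrt P x) = Ψ ∧ η + Ψ = x + C (invSqrt P x) := by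
  obtain ⟨D, hD, hDr⟩ := exists_isRaising_creationKernel P hf hf2
  obtain ⟨A, hA, hAr⟩ := exists_isRaising_dualCreationKernel P hf hf2
  exact ⟨_, norm_sqrt_smul_add_star_le α hD hA, fun U hU =>
    fieldPerturbation_eq_mul α (isSelfAdjoint_invSqrt P) (hU.ext hDr.invSqrt_mul)
      (hU.ext hAr.mul_invSqrt), mem_cutoffGraph_iff α hf2 hDr hAr⟩

end CutoffGraph

variable {α Λ : ℝ} {P : R3}

theorem isFormSum_cutoffHamiltonian (α : ℝ) {U : Fock →L[ℂ] Fock}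
    (hU : IsRaising (couplingKernel P (vHatCut Λ)) U) :
    IsFormSum (invSqrt P) (fieldPerturbation α U) (cutoffHamiltonian α Λ P) := by
  obtain ⟨C, -, hUC, hgraph⟩ :=
    exists_fieldPerturbation_factor α P (measurable_vHatCut Λ) (memLp_vHatCut Λ)
  intro Ψ η
  rw [cutoffHamiltonian_graph, hgraph, hUC U hU]
  exact (exists_form_eq_iff_of_factor (fun _ => rfl) Ψ η).symm

theorem cutoffHamiltonian_domain (α Λ : ℝ) (P : R3) :
    (cutoffHamiltonian α Λ P).domain = freeDomain P := by
  obtain ⟨C, -, -, hgraph⟩ :=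
    exists_fieldPerturbation_factor α P (measurable_vHatCut Λ) (memLp_vHatCut Λ)
  ext Ψ
  rw [mem_freeDomain_iff, LinearPMap.mem_domain_iff, cutoffHamiltonian_graph]
  constructor
  · rintro ⟨η, h⟩
    obtain ⟨x, hx, -⟩ := (hgraph Ψ η).1 h
    exact ⟨x, hx⟩
  · rintro ⟨x, hx⟩
    exact ⟨x + C (invSqrt P x) - Ψ, (hgraph _ _).2 ⟨x, hx, sub_add_cancel _ _⟩⟩

theorem exists_isRaising_couplingKernel_vHatCut (Λ : ℝ) (P : R3) :
    ∃ U : Fock →L[ℂ] Fock, IsRaising (couplingKernel P (vHatCut Λ)) U := by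
  obtain ⟨D, -, hD⟩ := exists_isRaising_creationKernel P (measurable_vHatCut Λ) (memLp_vHatCut Λ)
  exact ⟨_, hD.invSqrt_mul⟩

theorem cutoffHamiltonian_isSelfAdjoint (α Λ : ℝ) (P : R3) :
    IsSelfAdjoint (cutoffHamiltonian α Λ P) := by
  obtain ⟨U, hU⟩ := exists_isRaising_couplingKernel_vHatCut Λ P
  obtain ⟨C, hC, hUC, -⟩ :=
    exists_fieldPerturbation_factor α P (measurable_vHatCut Λ) (memLp_vHatCut Λ)
  have hlow := FormLowerBound.of_factor (isSelfAdjoint_invSqrt P) hC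
  rw [← hUC U hU] at hlow
  exact (isFormSum_cutoffHamiltonian α hU).isSelfAdjoint (isSelfAdjoint_invSqrt P)
    (isSelfAdjoint_fieldPerturbation α U) (by norm_num) hlow

section CutoffRemoval

variable {V : R3 → Fock →L[ℂ] Fock} {U : ℝ → R3 → Fock →L[ℂ] Fock}

theorem tendstoUniformly_fieldPerturbation (α : ℝ)
    (hV : ∀ P, IsRaising (couplingKernel P vHat) (V P))
    (hU : ∀ Λ P, IsRaising (couplingKernel P (vHatCut Λ)) (U Λ P)) :
    TendstoUniformly (fun Λ P => fieldPerturbation α (U Λ P))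
      (fun P => fieldPerturbation α (V P)) atTop := by
  have hlim : Tendsto (fun Λ =>
      2 * Real.sqrt α * (eLpNorm (weighted (vHat - vHatCut Λ)) 2).toReal) atTop (𝓝 0) := by
    simpa using ((ENNReal.tendsto_toReal ENNReal.zero_ne_top).comp
      tendsto_eLpNorm_weighted_vHat_sub_vHatCut).const_mul (2 * Real.sqrt α)
  rw [Metric.tendstoUniformly_iff]
  intro ε hε
  filter_upwards [hlim.eventually_lt_const hε] with Λ hΛ P
  rw [dist_eq_norm]
  refine (norm_fieldPerturbation_sub_le α _ _).trans_lt (lt_of_le_of_lt ?_ hΛ)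
  gcongr
  exact norm_sub_le_of_isRaising_couplingKernel measurable_vHat (measurable_vHatCut Λ)
    (memLp_weighted_vHat_sub_vHatCut Λ) (hV P) (hU Λ P)

theorem exists_formLowerBound_fieldPerturbation (α : ℝ)
    (hV : ∀ P, IsRaising (couplingKernel P vHat) (V P))
    (hU : ∀ Λ P, IsRaising (couplingKernel P (vHatCut Λ)) (U Λ P)) :
    ∃ M, (∀ᶠ Λ in atTop, ∀ P,
        FormLowerBound (invSqrt P) (fieldPerturbation α (U Λ P)) (1 / 2) M) ∧
      ∀ P, FormLowerBound (invSqrt P) (fieldPerturbation α (V P)) (1 / 2) M := by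
  refine exists_formLowerBound_of_tendstoUniformly isSelfAdjoint_invSqrt
    (Eventually.of_forall fun Λ => ⟨2 * Real.sqrt α * (eLpNorm (vHatCut Λ) 2).toReal, fun P => ?_⟩)
    (tendstoUniformly_fieldPerturbation α hV hU)
  obtain ⟨C, hC, hUC, -⟩ :=
    exists_fieldPerturbation_factor α P (measurable_vHatCut Λ) (memLp_vHatCut Λ)
  exact ⟨C, hC, hUC _ (hU Λ P)⟩

end CutoffRemoval

theorem fiberHamiltonian_isSelfAdjoint (α : ℝ) (P : R3) : IsSelfAdjoint (fiberHamiltonian α P) := by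
  choose V _ hV using fun P =>
    exists_isRaising_couplingKernel P measurable_vHat memLp_weighted_vHat
  choose U hU using exists_isRaising_couplingKernel_vHatCut
  obtain ⟨M, -, hlow⟩ := exists_formLowerBound_fieldPerturbation α hV hU
  exact (isFormSum_fiberHamiltonian α (hV P)).isSelfAdjoint (isSelfAdjoint_invSqrt P)
    (isSelfAdjoint_fieldPerturbation α _) (by norm_num) (hlow P)

theorem normResolventTendstoUniformly_cutoffHamiltonian (α : ℝ) :
    NormResolventTendstoUniformly atTop (fun (Λ : ℝ) (P : R3) => cutoffHamiltonian α Λ P)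
      (fun P : R3 => fiberHamiltonian α P) := by
  choose V _ hV using fun P =>
    exists_isRaising_couplingKernel P measurable_vHat memLp_weighted_vHat
  choose U hU using exists_isRaising_couplingKernel_vHatCut
  obtain ⟨M, hlow, hlow₀⟩ := exists_formLowerBound_fieldPerturbation α hV hU
  intro z hz
  have hunit {P : R3} {W : Fock →L[ℂ] Fock}
      (h : FormLowerBound (invSqrt P) (fieldPerturbation α W) (1 / 2) M) :
      IsUnit (pencil (invSqrt P) (fieldPerturbation α W) z) :=
    h.isUnit_pencil (by norm_num) (isSelfAdjoint_invSqrt P) (isSelfAdjoint_fieldPerturbation α W) hz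
  refine ⟨_, _, hlow.mono fun Λ hΛ P => ?_, fun P => ?_,
    tendstoUniformly_formResolvent isSelfAdjoint_invSqrt norm_invSqrt_le_one
      (fun Λ P => isSelfAdjoint_fieldPerturbation α (U Λ P))
      (fun P => isSelfAdjoint_fieldPerturbation α (V P)) (by norm_num) hlow hlow₀
      (tendstoUniformly_fieldPerturbation α hV hU) hz⟩
  · exact ((isFormSum_cutoffHamiltonian α (hU Λ P)).hasResolvent (hunit (hΛ P))).isResolventAt
  · exact ((isFormSum_fiberHamiltonian α (hV P)).hasResolvent (hunit (hlow₀ P))).isResolventAt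

end Polaron

end

theorem propositionA2 (α : ℝ) (hα : 0 < α) :
    (∀ Λ : ℝ, 0 < Λ → ∀ P : Polaron.R3,
      (Polaron.cutoffHamiltonian α Λ P).domain = Polaron.freeDomain P ∧
        IsSelfAdjoint (Polaron.cutoffHamiltonian α Λ P)) ∧
    (∀ P : Polaron.R3, IsSelfAdjoint (Polaron.fiberHamiltonian α P)) ∧
    Polaron.NormResolventTendstoUniformly atTop
      (fun (Λ : ℝ) (P : Polaron.R3) => Polaron.cutoffHamiltonian α Λ P)
      (fun P : Polaron.R3 => Polaron.fiberHamiltonian α P) :=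
  ⟨fun Λ _ P => ⟨Polaron.cutoffHamiltonian_domain α Λ P,
      Polaron.cutoffHamiltonian_isSelfAdjoint α Λ P⟩,
    Polaron.fiberHamiltonian_isSelfAdjoint α,
    Polaron.normResolventTendstoUniformly_cutoffHamiltonian α⟩
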